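/- Fix a countably infinite set $\Lambda$ of letters and a countably infinite set $\mathbb V$ of variables. First-order formulae over words are built from the atoms $\top$, $\bot$, $\mathsf{empty}$, $x=y$, $\lambda(x)=a$, $x<y$, $x\le y$, $\mathsf{suc}(x,y)$, $\min(x)$, $\max(x)$ ($x,y\in\mathbb V$, $a\in\Lambda$) with $\neg,\lor,\land,\exists x,\forall x$, and are interpreted in generalized words, i.e. (possibly empty) linear orders whose positions are labelled by letters; $\mathsf{empty}$ says that there is no position. A context $\mu$ is a formula with exactly one occurrence of a placeholder, and $\mu(\varphi)$ is the result of replacing the placeholder by $\varphi$. A fragment is a non-empty set $\mathcal F$ of formulae such that for all contexts $\mu$, formulae $\varphi,\psi$, letters $a$ and variables $x$: (i) $\mu(\varphi)\in\mathcal F$ implies $\mu(\top),\mu(\bot),\mu(\lambda(x)=a)\in\mathcal F$; (ii) $\mu(\varphi\lor\psi)\in\mathcal F$ iff $\mu(\varphi),\mu(\psi)\in\mathcal F$; (iii) $\mu(\varphi\land\psi)\in\mathcal F$ iff $\mu(\varphi),\mu(\psi)\in\mathcal F$; (iv) $\mu(\neg\neg\varphi)\in\mathcal F$ implies $\mu(\varphi)\in\mathcal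 F$; (v) if $x$ is not free in $\varphi$, then each of $\mu(\exists x\,\varphi)\in\mathcal F$ and $\mu(\forall x\,\varphi)\in\mathcal F$ implies $\mu(\varphi)\in\mathcal F$. It is order-stable if $\mu(x<y)\in\mathcal F$ iff $\mu(x\le y)\in\mathcal F$, for all $\mu,x,y$. A language $L\subseteq A^*$ over a finite alphabet $A\subseteq\Lambda$ is definable in $\mathcal F$ if $L$ is the set of all words in $A^*$ that satisfy some sentence $\varphi\in\mathcal F$. Its syntactic monoid is $M_L=A^*/{\equiv_L}$, where $u\equiv_L v$ iff for all $x,y\in A^*$: $xuy\in L\iff xvy\in L$. $\pi$-terms are built from letters with an associative product and a unary operation $(\cdot)^\pi$. An identity $s=t$ of $\pi$-terms holds in a finite monoid $M$ if for every map $\Lambda\to M$ the terms $s$ and $t$ get the same value when $u^\pi$ is interpreted as the unique idempotent among the powers $u^k$, $k\ge1$. Let $\varrho=\omega+\zeta\cdot\eta+\omega^*$, where $\omega,\zeta,\eta,\omega^*$ are the order types of $\mathbb N,\mathbb Z,\mathbb Q,\mathbb Z_{<0}$ and $\zeta\cdot\eta$ consists of $\eta$ copies of $\zeta$. The generalized word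 $[\![t]\!]_\varrho$ is the value of $t$ when a letter is interpreted as the one-position word, the product as concatenation, and $u^\pi$ as the $\varrho$-power of $u$ (replace each point of $\varrho$ by a copy of $u$). For $\mathsf Q\in\{\exists,\forall,\neg\exists,\neg\forall\}$ the reduct of $\mathcal G$ by $\mathsf Qx$ is $\{\varphi\mid \mathsf Qx\,\varphi\in\mathcal G\}$. The $\mathcal F$-game on words $(u,v)$ has configurations $(\mathcal G,\langle u,\alpha\rangle,\langle v,\beta\rangle)$, with valuations $\alpha,\beta$ of the same finite set of variables, and starts with $\mathcal G=\mathcal F$ and empty valuations. In a round, Spoiler chooses $\mathsf Q$ and $x$ such that the reduct of $\mathcal G$ by $\mathsf Qx$ is non-empty, and a position $q$, in the left word if $\mathsf Q\in\{\exists,\neg\forall\}$ and in the right word if $\mathsf Q\in\{\forall,\neg\exists\}$; Duplicator replies by a position $r$ in the other word. The new configuration consists of this reduct and the two valuations, with $x$ (re)assigned to the position just chosen in the respective word; for negated $\mathsf Q$ the left and the right word are also interchanged. A player who cannot choose loses. Spoiler also wins as soon as some literal (an atom or a negated atom) $\varphi\in\mathcal G$, all of whose variables are valued, is true in the left word and false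 in the right word. Duplicator wins all infinite plays. **Theorem.** Let $\mathcal F$ be an order-stable fragment in which none of the predicates $\mathsf{suc},\min,\max,\mathsf{empty}$ occurs. The syntactic monoid of every language definable in $\mathcal F$ is finite, and for all $\pi$-terms $s,t$ the following are equivalent: 1. The identity $s=t$ holds in the syntactic monoid of every language definable in $\mathcal F$. 2. Duplicator has winning strategies in the $\mathcal F$-games on $([\![s]\!]_\varrho,[\![t]\!]_\varrho)$ and on $([\![t]\!]_\varrho,[\![s]\!]_\varrho)$. -/

import Mathlib

namespace EFTerms

universe u v w

/-! ### π-terms and their interpretations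

`Λ` is the universe of letters. -/

/-- Syntax trees of π-terms over `Λ`: every element of the free π-algebra generated by `Λ` is
represented by such a tree, and two trees represent the same element iff they agree up to
re-bracketing of products. -/
inductive PiTerm (Λ : Type u) : Type u
  | letter (a : Λ) : PiTerm Λ
  | mul (s t : PiTerm Λ) : PiTerm Λ
  | pi (s : PiTerm Λ) : PiTerm Λ

/-- The value of a π-term in a carrier `U` with a product `mul` and a unary operation `pi`, under
the assignment `h` of the letters.  If `mul` is associative, these are exactly the π-algebra
morphisms from the free π-algebra to `(U, mul, pi)`. -/
def PiTerm.eval {Λ : Type u} {U : Type v} (mul : U → U → U) (pi : U → U) (h : Λ → U) :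
    PiTerm Λ → U
  | .letter a => h a
  | .mul s t => mul (s.eval mul pi h) (t.eval mul pi h)
  | .pi s => pi (s.eval mul pi h)

open Classical in
/-- The idempotent element of `{x ^ k | k ≥ 1}`.  In a finite monoid it exists, and there is never
more than one such element; the value `1` is used where there is none. -/
noncomputable def idemPow {M : Type v} [Monoid M] (x : M) : M :=
  if h : ∃ e : M, IsIdempotentElem e ∧ ∃ k : ℕ, 1 ≤ k ∧ x ^ k = e then h.choose else 1

/-- The identity `s = t` holds in the (finite) monoid `M`: all morphisms into the idempotency
algebra on `M` agree on `s` and `t`. -/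
def HoldsIn {Λ : Type u} (s t : PiTerm Λ) (M : Type v) [Monoid M] : Prop :=
  ∀ h : Λ → M, s.eval (· * ·) idemPow h = t.eval (· * ·) idemPow h

/-! ### Syntactic monoids -/

/-- The syntactic congruence of `L ⊆ A*`. -/
def syntacticCon {A : Type u} (L : Set (FreeMonoid A)) : Con (FreeMonoid A) where
  r p q := ∀ x y : FreeMonoid A, x * p * y ∈ L ↔ x * q * y ∈ L
  iseqv :=
    ⟨fun _ _ _ => Iff.rfl, fun h x y => (h x y).symm, fun h k x y => (h x y).trans (k x y)⟩
  mul' := by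
    intro p p' q q' hp hq x y
    have h1 := hp x (q * y)
    have h2 := hq (x * p') y
    simp only [mul_assoc] at h1 h2 ⊢
    exact h1.trans h2

/-- The syntactic monoid of `L ⊆ A*`. -/
abbrev SyntacticMonoid {A : Type u} (L : Set (FreeMonoid A)) : Type u :=
  (syntacticCon L).Quotient

/-! ### Generalized words -/

/-- A generalized word: a (possibly empty) linear order labelled by letters. -/
structure Word (Λ : Type u) : Type (max 1 u) where
  Pos : Type
  order : LinearOrder Pos
  label : Pos → Λ

attribute [instance] Word.order

namespace Word

variable {Λ : Type u}

/-- A finite word with positions `0, …, n - 1`. -/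
def ofList (l : List Λ) : Word Λ where
  Pos := Fin l.length
  order := inferInstance
  label i := l.get i

/-- The word with a single position labelled by `a`. -/
def single (a : Λ) : Word Λ where
  Pos := Unit
  order := inferInstance
  label _ := a

/-- Concatenation: the positions of `p` come before those of `q`. -/
def concat (p q : Word Λ) : Word Λ where
  Pos := p.Pos ⊕ₗ q.Pos
  order := inferInstance
  label i := Sum.elim p.label q.label (ofLex i)

/-- The `T`-power of a word: replace each point of the linear order `T` by a copy of `p`. -/
def power (p : Word Λ) (T : Type) [LinearOrder T] : Word Λ where
  Pos := T ×ₗ p.Pos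
  order := inferInstance
  label i := p.label (ofLex i).2

end Word

/-- A linear order of type `ϱ = ω + ζ·η + ω*`, where `ζ·η` consists of `η` copies of `ζ`. -/
abbrev Rho : Type := (ℕ ⊕ₗ (ℚ ×ₗ ℤ)) ⊕ₗ ℕᵒᵈ

/-- The generalized word `⟦t⟧_ϱ`. -/
def PiTerm.rhoWord {Λ : Type u} (t : PiTerm Λ) : Word Λ :=
  t.eval Word.concat (fun p => p.power Rho) Word.single

/-! ### First-order logic over words

`V` is the set of variables. -/

/-- Atomic formulae. -/
inductive Atom (Λ : Type u) (V : Type v) : Type (max u v)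
  | top : Atom Λ V
  | bot : Atom Λ V
  | empty : Atom Λ V
  | eq (x y : V) : Atom Λ V
  | label (x : V) (a : Λ) : Atom Λ V
  | lt (x y : V) : Atom Λ V
  | le (x y : V) : Atom Λ V
  | suc (x y : V) : Atom Λ V
  | min (x : V) : Atom Λ V
  | max (x : V) : Atom Λ V

/-- First-order formulae. -/
inductive Formula (Λ : Type u) (V : Type v) : Type (max u v)
  | atom (a : Atom Λ V) : Formula Λ V
  | neg (φ : Formula Λ V) : Formula Λ V
  | or (φ ψ : Formula Λ V) : Formula Λ V
  | and (φ ψ : Formula Λ V) : Formula Λ V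
  | ex (x : V) (φ : Formula Λ V) : Formula Λ V
  | all (x : V) (φ : Formula Λ V) : Formula Λ V

section Logic

variable {Λ : Type u} {V : Type v}

/-- The variables of an atomic formula. -/
def Atom.vars : Atom Λ V → Set V
  | .top | .bot | .empty => ∅
  | .eq x y | .lt x y | .le x y | .suc x y => {x, y}
  | .label x _ | .min x | .max x => {x}

/-- The free variables of a formula. -/
def Formula.freeVars : Formula Λ V → Set V
  | .atom a => a.vars
  | .neg φ => φ.freeVars
  | .or φ ψ | .and φ ψ => φ.freeVars ∪ ψ.freeVars
  | .ex x φ | .all x φ => φ.freeVars \ {x}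

/-- A sentence is a formula without free variables. -/
def Formula.IsSentence (φ : Formula Λ V) : Prop := φ.freeVars = ∅

/-- A literal is an atomic formula or the negation of one. -/
def Formula.IsLiteral (φ : Formula Λ V) : Prop :=
  ∃ a : Atom Λ V, φ = .atom a ∨ φ = .neg (.atom a)

/-- A valuation on `p` whose set of variables is `{x | α x ≠ none}`. -/
abbrev Valuation (V : Type v) (p : Word Λ) : Type v := V → Option p.Pos

/-- The set of variables of a valuation. -/
def Valuation.dom {p : Word Λ} (α : Valuation V p) : Set V := {x | α x ≠ none}

open Classical in
/-- The valuation `α[x/q]`. -/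
noncomputable def Valuation.extend {p : Word Λ} (α : Valuation V p) (x : V) (q : p.Pos) :
    Valuation V p :=
  fun y => if y = x then some q else α y

/-- The empty valuation. -/
def Valuation.none (V : Type v) (p : Word Λ) : Valuation V p := fun _ => Option.none

/-- Satisfaction of an atomic formula, all of whose variables are valued by `α`. -/
def Atom.Sat (p : Word Λ) (α : Valuation V p) : Atom Λ V → Prop
  | .top => True
  | .bot => False
  | .empty => IsEmpty p.Pos
  | .eq x y => ∃ i j, α x = some i ∧ α y = some j ∧ i = j
  | .label x a => ∃ i, α x = some i ∧ p.label i = a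
  | .lt x y => ∃ i j, α x = some i ∧ α y = some j ∧ i < j
  | .le x y => ∃ i j, α x = some i ∧ α y = some j ∧ i ≤ j
  | .suc x y => ∃ i j, α x = some i ∧ α y = some j ∧ i ⋖ j
  | .min x => ∃ i, α x = some i ∧ ∀ j, i ≤ j
  | .max x => ∃ i, α x = some i ∧ ∀ j, j ≤ i

/-- Satisfaction of a formula, all of whose free variables are valued by `α`. -/
def Formula.Sat (p : Word Λ) : Valuation V p → Formula Λ V → Prop
  | α, .atom a => a.Sat p α
  | α, .neg φ => ¬ φ.Sat p α
  | α, .or φ ψ => φ.Sat p α ∨ ψ.Sat p α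
  | α, .and φ ψ => φ.Sat p α ∧ ψ.Sat p α
  | α, .ex x φ => ∃ q : p.Pos, φ.Sat p (Valuation.extend α x q)
  | α, .all x φ => ∀ q : p.Pos, φ.Sat p (Valuation.extend α x q)

/-- The sentence `φ` is true in the word `p`. -/
def Models (p : Word Λ) (φ : Formula Λ V) : Prop := φ.Sat p (Valuation.none V p)

/-- The language over the finite alphabet `A ⊆ Λ` defined by the sentence `φ`. -/
def langOf (A : Finset Λ) (φ : Formula Λ V) : Set (FreeMonoid A) :=
  {w | Models (Word.ofList (w.toList.map Subtype.val)) φ}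

/-- `L ⊆ A*` is definable in the class `F` of formulae. -/
def IsDefinableIn (F : Set (Formula Λ V)) (A : Finset Λ) (L : Set (FreeMonoid A)) : Prop :=
  ∃ φ ∈ F, φ.IsSentence ∧ L = langOf A φ

end Logic

/-! ### Fragments -/

/-- Formulae with a unique occurrence of a placeholder. -/
inductive Context (Λ : Type u) (V : Type v) : Type (max u v)
  | hole : Context Λ V
  | neg (μ : Context Λ V) : Context Λ V
  | orLeft (μ : Context Λ V) (ψ : Formula Λ V) : Context Λ V
  | orRight (ψ : Formula Λ V) (μ : Context Λ V) : Context Λ V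
  | andLeft (μ : Context Λ V) (ψ : Formula Λ V) : Context Λ V
  | andRight (ψ : Formula Λ V) (μ : Context Λ V) : Context Λ V
  | ex (x : V) (μ : Context Λ V) : Context Λ V
  | all (x : V) (μ : Context Λ V) : Context Λ V

section Fragments

variable {Λ : Type u} {V : Type v}

/-- Replace the placeholder by `φ` (variables may be captured). -/
def Context.fill : Context Λ V → Formula Λ V → Formula Λ V
  | .hole, φ => φ
  | .neg μ, φ => .neg (μ.fill φ)
  | .orLeft μ ψ, φ => .or (μ.fill φ) ψ
  | .orRight ψ μ, φ => .or ψ (μ.fill φ)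
  | .andLeft μ ψ, φ => .and (μ.fill φ) ψ
  | .andRight ψ μ, φ => .and ψ (μ.fill φ)
  | .ex x μ, φ => .ex x (μ.fill φ)
  | .all x μ, φ => .all x (μ.fill φ)

/-- Fragments of first-order logic. -/
structure IsFragment (F : Set (Formula Λ V)) : Prop where
  nonempty : F.Nonempty
  top : ∀ (μ : Context Λ V) (φ : Formula Λ V), μ.fill φ ∈ F → μ.fill (.atom .top) ∈ F
  bot : ∀ (μ : Context Λ V) (φ : Formula Λ V), μ.fill φ ∈ F → μ.fill (.atom .bot) ∈ F
  label : ∀ (μ : Context Λ V) (φ : Formula Λ V) (x : V) (a : Λ),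
    μ.fill φ ∈ F → μ.fill (.atom (.label x a)) ∈ F
  or : ∀ (μ : Context Λ V) (φ ψ : Formula Λ V),
    μ.fill (.or φ ψ) ∈ F ↔ μ.fill φ ∈ F ∧ μ.fill ψ ∈ F
  and : ∀ (μ : Context Λ V) (φ ψ : Formula Λ V),
    μ.fill (.and φ ψ) ∈ F ↔ μ.fill φ ∈ F ∧ μ.fill ψ ∈ F
  neg_neg : ∀ (μ : Context Λ V) (φ : Formula Λ V),
    μ.fill (.neg (.neg φ)) ∈ F → μ.fill φ ∈ F
  ex : ∀ (μ : Context Λ V) (x : V) (φ : Formula Λ V),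
    μ.fill (.ex x φ) ∈ F → x ∉ φ.freeVars → μ.fill φ ∈ F
  all : ∀ (μ : Context Λ V) (x : V) (φ : Formula Λ V),
    μ.fill (.all x φ) ∈ F → x ∉ φ.freeVars → μ.fill φ ∈ F

/-- Order-stability. -/
def IsOrderStable (F : Set (Formula Λ V)) : Prop :=
  ∀ (μ : Context Λ V) (x y : V), μ.fill (.atom (.lt x y)) ∈ F ↔ μ.fill (.atom (.le x y)) ∈ F

/-- The predicate of the atomic formula is one of `suc`, `min`, `max`, `empty`. -/
def Atom.IsSucMinMaxEmpty : Atom Λ V → Prop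
  | .suc _ _ | .min _ | .max _ | .empty => True
  | _ => False

/-- None of the predicates `suc`, `min`, `max`, `empty` occurs in the formula. -/
def Formula.AvoidsSucMinMaxEmpty : Formula Λ V → Prop
  | .atom a => ¬ a.IsSucMinMaxEmpty
  | .neg φ => φ.AvoidsSucMinMaxEmpty
  | .or φ ψ | .and φ ψ => φ.AvoidsSucMinMaxEmpty ∧ ψ.AvoidsSucMinMaxEmpty
  | .ex _ φ | .all _ φ => φ.AvoidsSucMinMaxEmpty

end Fragments

/-! ### The game -/

/-- The quantifiers `∃`, `∀`, `¬∃`, `¬∀`. -/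
inductive Quant
  | ex
  | all
  | notEx
  | notAll

section Game

variable {Λ : Type u} {V : Type v}

/-- The formula `Q x φ`. -/
def Quant.bind : Quant → V → Formula Λ V → Formula Λ V
  | .ex, x, φ => .ex x φ
  | .all, x, φ => .all x φ
  | .notEx, x, φ => .neg (.ex x φ)
  | .notAll, x, φ => .neg (.all x φ)

/-- The reduct of `F` by `Q x`. -/
def reduct (Q : Quant) (x : V) (F : Set (Formula Λ V)) : Set (Formula Λ V) :=
  {φ | Q.bind x φ ∈ F}

/-- Configurations of the game. -/
structure Config (Λ : Type u) (V : Type v) : Type (max 1 u v) where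
  frag : Set (Formula Λ V)
  left : Word Λ
  leftVal : Valuation V left
  right : Word Λ
  rightVal : Valuation V right

/-- The initial configuration of the `F`-game on `(p, q)`. -/
def Config.start (F : Set (Formula Λ V)) (p q : Word Λ) : Config Λ V :=
  ⟨F, p, Valuation.none V p, q, Valuation.none V q⟩

/-- The word in which Spoiler chooses a position. -/
def Config.questWord (S : Config Λ V) : Quant → Word Λ
  | .ex | .notAll => S.left
  | .all | .notEx => S.right

/-- The word in which Duplicator has to reply. -/
def Config.replyWord (S : Config Λ V) : Quant → Word Λ
  | .ex | .notAll => S.right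
  | .all | .notEx => S.left

/-- The choices of Spoiler in a round: a quantifier and a variable for which the reduct is not
empty, and a position. -/
structure Config.Challenge (S : Config Λ V) : Type v where
  quant : Quant
  var : V
  legal : (reduct quant var S.frag).Nonempty
  quest : (S.questWord quant).Pos

/-- The configuration after a round in which Duplicator replies to the challenge by `r`; for
negated quantifiers the two words are interchanged. -/
noncomputable def Config.next (S : Config Λ V) :
    (c : S.Challenge) → (S.replyWord c.quant).Pos → Config Λ V
  | ⟨.ex, x, _, q⟩, r =>
      ⟨reduct .ex x S.frag, S.left, S.leftVal.extend x q, S.right, S.rightVal.extend x r⟩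
  | ⟨.all, x, _, q⟩, r =>
      ⟨reduct .all x S.frag, S.left, S.leftVal.extend x r, S.right, S.rightVal.extend x q⟩
  | ⟨.notEx, x, _, q⟩, r =>
      ⟨reduct .notEx x S.frag, S.right, S.rightVal.extend x q, S.left, S.leftVal.extend x r⟩
  | ⟨.notAll, x, _, q⟩, r =>
      ⟨reduct .notAll x S.frag, S.right, S.rightVal.extend x r, S.left, S.leftVal.extend x q⟩

/-- Spoiler's winning condition: some literal of the current fragment, whose variables are all
valued (both valuations always have the same variables), is true on the left and false on the
right. -/
def Config.SpoilerWon (S : Config Λ V) : Prop :=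
  ∃ φ ∈ S.frag, φ.IsLiteral ∧ φ.freeVars ⊆ S.leftVal.dom ∧
    φ.Sat S.left S.leftVal ∧ ¬ φ.Sat S.right S.rightVal

/-- Histories of the game starting in `S₀`, indexed by the current configuration. -/
inductive History (S₀ : Config Λ V) : Config Λ V → Type (max 1 u v)
  | init : History S₀ S₀
  | round {S : Config Λ V} (H : History S₀ S) (c : S.Challenge)
      (r : (S.replyWord c.quant).Pos) : History S₀ (S.next c r)

/-- A strategy of Duplicator: a partial map that assigns a reply to a history and a challenge. -/
def Strategy (S₀ : Config Λ V) : Type (max 1 u v) :=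
  (S : Config Λ V) → History S₀ S → (c : S.Challenge) → Option (S.replyWord c.quant).Pos

/-- In the history, all replies follow the strategy `σ`. -/
def Strategy.Follows {S₀ : Config Λ V} (σ : Strategy S₀) :
    {S : Config Λ V} → History S₀ S → Prop
  | _, .init => True
  | _, .round H c r => σ.Follows H ∧ σ _ H c = some r

/-- The strategy is winning for Duplicator: along every history that follows it, Spoiler's winning
condition is not met and every challenge of Spoiler gets a reply.  (So she wins all infinite
plays, and those in which Spoiler has no challenge left.) -/
def Strategy.IsWinning {S₀ : Config Λ V} (σ : Strategy S₀) : Prop :=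
  ∀ (S : Config Λ V) (H : History S₀ S), σ.Follows H →
    ¬ S.SpoilerWon ∧ ∀ c : S.Challenge, ∃ r, σ S H c = some r

/-- Duplicator has a winning strategy in the `F`-game on `(p, q)`. -/
def DuplicatorWins (F : Set (Formula Λ V)) (p q : Word Λ) : Prop :=
  ∃ σ : Strategy (Config.start F p q), σ.IsWinning

end Game

end EFTerms

/-! Call words `n`-equivalent if Duplicator survives the classical `n`-round Ehrenfeucht-Fraïssé
game, `BF`. This relation respects concatenation and powers, and it preserves sentences of depth at
most `n` without `suc`, `min`, `max`, `empty` (`BF.models_iff`). As there are finitely many types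
over a finite alphabet, syntactic monoids are finite. Moreover `ϱ` is `n`-equivalent to every finite
order of more than `2 ^ n` points (`bf_fin_rho`). Hence in the syntactic monoid of a sentence of
depth `n` the `π`-power is the `(m + 1)`-st power for every `m ≥ 2 ^ n`, and replacing `ϱ` by this
exponent turns `⟦s⟧_ϱ` into an `n`-equivalent finite word (`eval_syntacticMonoid`,
`PiTerm.bf_finWord`).

From identities to games: these approximations show that every sentence of the fragment that is true
in `⟦s⟧_ϱ` is true in `⟦t⟧_ϱ`. Duplicator plays so that all formulae of the current reduct stay
preserved. Her reply must satisfy infinitely many formulae at once. It exists because `ϱ`-words are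
saturated (`PiTerm.saturated_rhoWord`): `ϱ` is discrete with endpoints, and every infinite interval
contains a point infinitely far from both ends. Singletons are saturated, and sums and lexicographic
products inherit the property.

From games to identities: an identity in a syntactic monoid speaks of arbitrary words in place of
the letters and of arbitrary contexts `X _ Y`. A simulation on `⟦s⟧_ϱ` and `⟦t⟧_ϱ` transfers
formulae to the substituted words in context (`Controlled.sat`). Quantifiers that pick positions in
`X` or `Y` become vacuous and are erased by the closure rules. Label atoms make replies carry the
same letter, so a position inside the substituted word can be copied. Order-stability handles the
resulting lexicographic comparison. The two games give the two implications between membership of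
the words for `s` and for `t`. -/

namespace EFTerms

/-! ### Back-and-forth systems of finite depth -/

section BackAndForth

universe u
variable {Λ : Type u} {P Q R T : Type*} [LinearOrder P] [LinearOrder Q] [LinearOrder R]
  [LinearOrder T]

/-- Duplicator survives `n` rounds of the Ehrenfeucht-Fraïssé game on the linear orders `P` and
`Q`, labelled by `f` and `g`, starting from the set `S` of pairs of chosen positions. -/
def BF (f : P → Λ) (g : Q → Λ) : ℕ → Set (P × Q) → Prop
  | 0, S => ∀ x ∈ S, f x.1 = g x.2 ∧ ∀ y ∈ S, (x.1 < y.1 ↔ x.2 < y.2)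
  | n + 1, S => (∀ a, ∃ b, BF f g n (insert (a, b) S)) ∧ ∀ b, ∃ a, BF f g n (insert (a, b) S)

variable {f : P → Λ} {g : Q → Λ} {h : R → Λ} {n : ℕ}

theorem BF.mono {S S' : Set (P × Q)} (hS : BF f g n S) (hs : S' ⊆ S) : BF f g n S' := by
  induction n generalizing S S' with
  | zero => exact fun x hx => ⟨(hS x (hs hx)).1, fun y hy => (hS x (hs hx)).2 y (hs hy)⟩
  | succ n ih =>
    refine ⟨fun a => ?_, fun b => ?_⟩
    · obtain ⟨b, hb⟩ := hS.1 a
      exact ⟨b, ih hb (Set.insert_subset_insert hs)⟩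
    · obtain ⟨a, ha⟩ := hS.2 b
      exact ⟨a, ih ha (Set.insert_subset_insert hs)⟩

theorem BF.zero {S : Set (P × Q)} (hS : BF f g n S) : BF f g 0 S := by
  induction n generalizing S with
  | zero => exact hS
  | succ n ih =>
    intro x hx
    obtain ⟨b, hb⟩ := hS.1 x.1
    have h0 := ih hb x (Set.mem_insert_of_mem _ hx)
    exact ⟨h0.1, fun y hy => h0.2 y (Set.mem_insert_of_mem _ hy)⟩

theorem BF.label_eq {S : Set (P × Q)} (hS : BF f g n S) {a : P} {b : Q} (hx : (a, b) ∈ S) :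
    f a = g b :=
  (hS.zero _ hx).1

theorem BF.lt_iff {S : Set (P × Q)} (hS : BF f g n S) {a a' : P} {b b' : Q} (hx : (a, b) ∈ S)
    (hy : (a', b') ∈ S) : a < a' ↔ b < b' :=
  (hS.zero _ hx).2 _ hy

theorem BF.eq_iff {S : Set (P × Q)} (hS : BF f g n S) {a a' : P} {b b' : Q} (hx : (a, b) ∈ S)
    (hy : (a', b') ∈ S) : a = a' ↔ b = b' := by
  have h1 := hS.lt_iff hx hy
  have h2 := hS.lt_iff hy hx
  rw [← not_iff_not, ← ne_eq, ← ne_eq, lt_or_lt_iff_ne.symm, lt_or_lt_iff_ne.symm, h1, h2]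

theorem BF.of_graph {e : P → Q} (he : StrictMono e) (hsurj : Function.Surjective e)
    (hl : ∀ a, f a = g (e a)) {S : Set (P × Q)} (hS : ∀ x ∈ S, x.2 = e x.1) : BF f g n S := by
  induction n generalizing S with
  | zero =>
    intro x hx
    refine ⟨by rw [hS x hx, hl], fun y hy => ?_⟩
    rw [hS x hx, hS y hy, he.lt_iff_lt]
  | succ n ih =>
    refine ⟨fun a => ⟨e a, ih ?_⟩, fun b => ?_⟩
    · rintro x (rfl | hx)
      · rfl
      · exact hS x hx
    · obtain ⟨a, rfl⟩ := hsurj b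
      refine ⟨a, ih ?_⟩
      rintro x (rfl | hx)
      · rfl
      · exact hS x hx

/-- A wasted round only adds a pair, which can be forgotten. If `P` is empty, no position of `Q`
could be answered, so `Q` is empty too and the empty map is an isomorphism. -/
theorem BF.of_succ {S : Set (P × Q)} (hS : BF f g (n + 1) S) : BF f g n S := by
  obtain ⟨h1, h2⟩ := hS
  by_cases hP : Nonempty P
  · obtain ⟨b, hb⟩ := h1 hP.some
    exact hb.mono (Set.subset_insert _ _)
  · exact BF.of_graph (e := fun a => (hP ⟨a⟩).elim) (fun a => (hP ⟨a⟩).elim)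
      (fun b => (hP ⟨(h2 b).choose⟩).elim) (fun a => (hP ⟨a⟩).elim) (fun x => (hP ⟨x.1⟩).elim)

theorem BF.refl {S : Set (P × P)} (hS : ∀ x ∈ S, x.2 = x.1) : BF f f n S :=
  BF.of_graph (e := id) strictMono_id Function.surjective_id (fun _ => rfl) hS

theorem BF.symm {S : Set (P × Q)} (hS : BF f g n S) : BF g f n {x | (x.2, x.1) ∈ S} := by
  induction n generalizing S with
  | zero => exact fun x hx => ⟨(hS.label_eq hx).symm, fun y hy => (hS.lt_iff hx hy).symm⟩
  | succ n ih =>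
    refine ⟨fun b => ?_, fun a => ?_⟩
    · obtain ⟨a, ha⟩ := hS.2 b
      refine ⟨a, (ih ha).mono ?_⟩
      rintro x (rfl | hx)
      · exact Set.mem_insert _ _
      · exact Set.mem_insert_of_mem _ hx
    · obtain ⟨b, hb⟩ := hS.1 a
      refine ⟨b, (ih hb).mono ?_⟩
      rintro x (rfl | hx)
      · exact Set.mem_insert _ _
      · exact Set.mem_insert_of_mem _ hx

theorem BF.comp {S : Set (P × Q)} {S' : Set (Q × R)} (hS : BF f g n S) (hS' : BF g h n S') :
    BF f h n {x | ∃ b, (x.1, b) ∈ S ∧ (b, x.2) ∈ S'} := by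
  induction n generalizing S S' with
  | zero =>
    rintro x ⟨b, h1, h2⟩
    refine ⟨(hS.label_eq h1).trans (hS'.label_eq h2), ?_⟩
    rintro y ⟨b', h1', h2'⟩
    exact (hS.lt_iff h1 h1').trans (hS'.lt_iff h2 h2')
  | succ n ih =>
    have key : ∀ a b c, insert (a, c) {x : P × R | ∃ b, (x.1, b) ∈ S ∧ (b, x.2) ∈ S'} ⊆
        {x | ∃ b', (x.1, b') ∈ insert (a, b) S ∧ (b', x.2) ∈ insert (b, c) S'} := by
      rintro a b c x (rfl | ⟨b', h1, h2⟩)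
      · exact ⟨b, Set.mem_insert _ _, Set.mem_insert _ _⟩
      · exact ⟨b', Set.mem_insert_of_mem _ h1, Set.mem_insert_of_mem _ h2⟩
    refine ⟨fun a => ?_, fun c => ?_⟩
    · obtain ⟨b, hb⟩ := hS.1 a
      obtain ⟨c, hc⟩ := hS'.1 b
      exact ⟨c, (ih hb hc).mono (key a b c)⟩
    · obtain ⟨b, hb⟩ := hS'.2 c
      obtain ⟨a, ha⟩ := hS.2 b
      exact ⟨a, (ih ha hb).mono (key a b c)⟩

theorem BF.symm_empty (hS : BF f g n ∅) : BF g f n ∅ := hS.symm.mono (Set.empty_subset _)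

theorem BF.trans_empty (hS : BF f g n ∅) (hS' : BF g h n ∅) : BF f h n ∅ :=
  (hS.comp hS').mono (Set.empty_subset _)

/-- The pairs of positions in two concatenations that come from pairs in the first, or from pairs
in the second factors. -/
def sumPairs {P P' Q Q' : Type*} (S : Set (P × P')) (S' : Set (Q × Q')) :
    Set ((P ⊕ₗ Q) × (P' ⊕ₗ Q')) :=
  {x | (∃ a b, (a, b) ∈ S ∧ x = (toLex (Sum.inl a), toLex (Sum.inl b))) ∨
    ∃ a b, (a, b) ∈ S' ∧ x = (toLex (Sum.inr a), toLex (Sum.inr b))}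

/-- Duplicator answers in the summand where Spoiler moves; the other local game forfeits a round.
Comparisons across the summands do not depend on the positions. -/
theorem BF.sum {P P' Q Q' : Type*} [LinearOrder P] [LinearOrder P'] [LinearOrder Q]
    [LinearOrder Q'] {f : P → Λ} {f' : P' → Λ} {g : Q → Λ} {g' : Q' → Λ}
    {S : Set (P × P')} {S' : Set (Q × Q')} (hS : BF f f' n S) (hS' : BF g g' n S') :
    BF (fun i : P ⊕ₗ Q => Sum.elim f g (ofLex i)) (fun i : P' ⊕ₗ Q' => Sum.elim f' g' (ofLex i)) n
      (sumPairs S S') := by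
  induction n generalizing S S' with
  | zero =>
    rintro _ (⟨a, b, h1, rfl⟩ | ⟨a, b, h1, rfl⟩)
    · refine ⟨hS.label_eq h1, ?_⟩
      rintro _ (⟨a', b', h2, rfl⟩ | ⟨a', b', h2, rfl⟩)
      · simpa using hS.lt_iff h1 h2
      · simp
    · refine ⟨hS'.label_eq h1, ?_⟩
      rintro _ (⟨a', b', h2, rfl⟩ | ⟨a', b', h2, rfl⟩)
      · simp
      · simpa using hS'.lt_iff h1 h2
  | succ n ih =>
    have keyl : ∀ a b, insert (toLex (Sum.inl a), toLex (Sum.inl b)) (sumPairs S S') ⊆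
        sumPairs (insert (a, b) S) S' := by
      rintro a b _ (rfl | ⟨a', b', h1, rfl⟩ | ⟨a', b', h1, rfl⟩)
      · exact .inl ⟨a, b, Set.mem_insert _ _, rfl⟩
      · exact .inl ⟨a', b', Set.mem_insert_of_mem _ h1, rfl⟩
      · exact .inr ⟨a', b', h1, rfl⟩
    have keyr : ∀ a b, insert (toLex (Sum.inr a), toLex (Sum.inr b)) (sumPairs S S') ⊆
        sumPairs S (insert (a, b) S') := by
      rintro a b _ (rfl | ⟨a', b', h1, rfl⟩ | ⟨a', b', h1, rfl⟩)
      · exact .inr ⟨a, b, Set.mem_insert _ _, rfl⟩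
      · exact .inl ⟨a', b', h1, rfl⟩
      · exact .inr ⟨a', b', Set.mem_insert_of_mem _ h1, rfl⟩
    refine ⟨fun a => ?_, fun b => ?_⟩
    · rcases a with a | a
      · obtain ⟨b, hb⟩ := hS.1 a
        exact ⟨_, (ih hb hS'.of_succ).mono (keyl a b)⟩
      · obtain ⟨b, hb⟩ := hS'.1 a
        exact ⟨_, (ih hS.of_succ hb).mono (keyr a b)⟩
    · rcases b with b | b
      · obtain ⟨a, ha⟩ := hS.2 b
        exact ⟨_, (ih ha hS'.of_succ).mono (keyl a b)⟩
      · obtain ⟨a, ha⟩ := hS'.2 b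
        exact ⟨_, (ih hS.of_succ ha).mono (keyr a b)⟩

/-- The pairs of positions in two lexicographic products whose first components form a pair in `S`,
and whose second components form a pair in the set that `F` assigns to the first components. -/
def prodPairs {T T' P P' : Type*} (S : Set (T × T')) (F : T → T' → Set (P × P')) :
    Set ((T ×ₗ P) × (T' ×ₗ P')) :=
  {x | ((ofLex x.1).1, (ofLex x.2).1) ∈ S ∧
    ((ofLex x.1).2, (ofLex x.2).2) ∈ F (ofLex x.1).1 (ofLex x.2).1}

/-- One game runs on the index orders, and a separate one on `P` and `P'` for each pair of indices.
A move is answered first in the index game, then in the game of the resulting pair, which alone gets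
a new entry. Equal indices correspond to equal indices, so the local games decide the ties. -/
theorem BF.prod {T T' P P' : Type*} [LinearOrder T] [LinearOrder T'] [LinearOrder P]
    [LinearOrder P'] {f : P → Λ} {f' : P' → Λ} {S : Set (T × T')} {F : T → T' → Set (P × P')}
    (hS : BF (fun _ : T => ()) (fun _ : T' => ()) n S) (hF : ∀ t t', BF f f' n (F t t')) :
    BF (fun i : T ×ₗ P => f (ofLex i).2) (fun i : T' ×ₗ P' => f' (ofLex i).2) n
      (prodPairs S F) := by
  classical
  induction n generalizing S F with
  | zero =>
    rintro ⟨x, x'⟩ ⟨h1, h2⟩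
    refine ⟨(hF _ _).label_eq h2, ?_⟩
    rintro ⟨y, y'⟩ ⟨h3, h4⟩
    rw [Prod.Lex.lt_iff, Prod.Lex.lt_iff]
    refine or_congr (hS.lt_iff h1 h3) ?_
    rw [hS.eq_iff h1 h3]
    refine and_congr_right fun he => ?_
    have he' := (hS.eq_iff h1 h3).2 he
    simp only [← he, ← he'] at h4
    exact (hF _ _).lt_iff h2 h4
  | succ n ih =>
    have key : ∀ t t' i i', insert (toLex (t, i), toLex (t', i')) (prodPairs S F) ⊆
        prodPairs (insert (t, t') S)
          (fun s s' => if s = t ∧ s' = t' then insert (i, i') (F t t') else F s s') := by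
      rintro t t' i i' x (rfl | ⟨h1, h2⟩)
      · refine ⟨Set.mem_insert _ _, ?_⟩
        simp
      · refine ⟨Set.mem_insert_of_mem _ h1, ?_⟩
        dsimp only
        split_ifs with he
        · rw [he.1, he.2] at h2
          exact Set.mem_insert_of_mem _ h2
        · exact h2
    have key' : ∀ t t' i i', BF f f' n (insert (i, i') (F t t')) → ∀ s s', BF f f' n
        (if s = t ∧ s' = t' then insert (i, i') (F t t') else F s s') := by
      intro t t' i i' h s s'
      split_ifs
      · exact h
      · exact (hF s s').of_succ
    refine ⟨fun a => ?_, fun b => ?_⟩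
    · obtain ⟨t', ht⟩ := hS.1 (ofLex a).1
      obtain ⟨i', hi⟩ := (hF (ofLex a).1 t').1 (ofLex a).2
      exact ⟨toLex (t', i'), (ih ht (key' _ _ _ _ hi)).mono (key _ _ _ _)⟩
    · obtain ⟨t, ht⟩ := hS.2 (ofLex b).1
      obtain ⟨i, hi⟩ := (hF t (ofLex b).1).2 (ofLex b).2
      exact ⟨toLex (t, i), (ih ht (key' _ _ _ _ hi)).mono (key _ _ _ _)⟩

theorem BF.prod_empty {T T' P P' : Type*} [LinearOrder T] [LinearOrder T'] [LinearOrder P]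
    [LinearOrder P'] {f : P → Λ} {f' : P' → Λ}
    (hT : BF (fun _ : T => ()) (fun _ : T' => ()) n ∅) (hF : BF f f' n ∅) :
    BF (fun i : T ×ₗ P => f (ofLex i).2) (fun i : T' ×ₗ P' => f' (ofLex i).2) n ∅ :=
  (BF.prod hT (F := fun _ _ => ∅) fun _ _ => hF).mono (Set.empty_subset _)

theorem BF.sum_empty {P P' Q Q' : Type*} [LinearOrder P] [LinearOrder P'] [LinearOrder Q]
    [LinearOrder Q'] {f : P → Λ} {f' : P' → Λ} {g : Q → Λ} {g' : Q' → Λ}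
    (hS : BF f f' n ∅) (hS' : BF g g' n ∅) :
    BF (fun i : P ⊕ₗ Q => Sum.elim f g (ofLex i)) (fun i : P' ⊕ₗ Q' => Sum.elim f' g' (ofLex i)) n
      ∅ :=
  (BF.sum hS hS').mono (Set.empty_subset _)

end BackAndForth
/-! ### The distance game on discrete linear orders -/

section Distance

variable {P Q : Type*} [LinearOrder P] [LinearOrder Q]

/-- Two cardinalities are equal, or both are at least the threshold `t`. -/
def Close (t : ℕ) (k l : ℕ∞) : Prop := k = l ∨ (t ≤ k ∧ t ≤ l)

theorem Close.symm {t : ℕ} {k l : ℕ∞} (h : Close t k l) : Close t l k :=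
  h.imp Eq.symm And.symm

theorem Close.mono {t t' : ℕ} {k l : ℕ∞} (h : Close t k l) (ht : t' ≤ t) : Close t' k l :=
  h.imp id fun h => ⟨le_trans (by exact_mod_cast ht) h.1, le_trans (by exact_mod_cast ht) h.2⟩

theorem Close.add {t : ℕ} {k l k' l' : ℕ∞} (h : Close t k l) (h' : Close t k' l') :
    Close t (k + 1 + k') (l + 1 + l') := by
  rcases h with rfl | ⟨h1, h2⟩
  · rcases h' with rfl | ⟨h1, h2⟩
    · exact .inl rfl
    · exact .inr ⟨h1.trans le_add_self, h2.trans le_add_self⟩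
  · exact .inr ⟨h1.trans (by rw [add_assoc]; exact le_self_add),
      h2.trans (by rw [add_assoc]; exact le_self_add)⟩

/-- Removing `k + 1 ≤ t` points from at least `2 * t + 1` leaves more than `t`. -/
theorem Close.cancel {t k : ℕ} (hk : k < t) {l l' : ℕ∞}
    (h : Close (2 * t + 1) (k + 1 + l) (k + 1 + l')) : Close t l l' := by
  have key : ∀ m : ℕ∞, ((2 * t + 1 : ℕ) : ℕ∞) ≤ k + 1 + m → (t : ℕ∞) ≤ m := by
    intro m hm
    cases m using ENat.recTopCoe
    · simp
    · norm_cast at *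
      omega
  rcases h with h | ⟨h1, h2⟩
  · left
    cases l using ENat.recTopCoe <;> cases l' using ENat.recTopCoe
    · rfl
    · norm_cast at h
    · norm_cast at h
    · norm_cast at *
      omega
  · exact .inr ⟨key _ h1, key _ h2⟩

theorem encard_Ioo_add {a b c : P} (hab : a < b) (hbc : b < c) :
    (Set.Ioo a c).encard = (Set.Ioo a b).encard + 1 + (Set.Ioo b c).encard := by
  have h : Set.Ioo a c = (Set.Ioo a b ∪ {b}) ∪ Set.Ioo b c := by
    ext x
    simp only [Set.mem_Ioo, Set.mem_union, Set.mem_singleton_iff]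
    constructor
    · rintro ⟨h1, h2⟩
      rcases lt_trichotomy x b with h | h | h <;> simp [*]
    · rintro ((⟨h1, h2⟩ | rfl) | ⟨h1, h2⟩)
      · exact ⟨h1, h2.trans hbc⟩
      · exact ⟨hab, hbc⟩
      · exact ⟨hab.trans h1, h2⟩
  rw [h, Set.encard_union_eq, Set.encard_union_eq, Set.encard_singleton]
  · simp
  · rw [Set.disjoint_left]
    rintro x (⟨_, h1⟩ | rfl) ⟨h2, _⟩
    · exact lt_asymm h1 h2
    · exact lt_irrefl _ h2

/-- Every position except for the last one has a successor, and every position except for the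
first one has a predecessor. -/
structure IsDiscrete (P : Type*) [LinearOrder P] : Prop where
  succ : ∀ a b : P, a < b → ∃ c, a < c ∧ ∀ d, a < d → c ≤ d
  pred : ∀ a b : P, a < b → ∃ c, c < b ∧ ∀ d, d < b → d ≤ c

theorem IsDiscrete.exists_right (hP : IsDiscrete P) (k : ℕ) {a b : P} (hab : a < b)
    (hk : (k : ℕ∞) < (Set.Ioo a b).encard) : ∃ c ∈ Set.Ioo a b, (Set.Ioo a c).encard = k := by
  have key : ∀ c, c < b → (Set.Ioo c b).encard ≠ 0 →
      ∃ d ∈ Set.Ioo c b, (Set.Ioo c d).encard = 0 := by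
    intro c hc h
    obtain ⟨x, hx⟩ := Set.encard_ne_zero.1 h
    obtain ⟨d, hd, hd'⟩ := hP.succ c b hc
    refine ⟨d, ⟨hd, (hd' x hx.1).trans_lt hx.2⟩, ?_⟩
    rw [Set.encard_eq_zero, Set.eq_empty_iff_forall_notMem]
    exact fun y hy => (hd' y hy.1).not_gt hy.2
  induction k with
  | zero => simpa using key a hab (fun h => by simp [h] at hk)
  | succ k ih =>
    obtain ⟨c, hc, hck⟩ := ih (lt_of_le_of_lt (by norm_cast; omega) hk)
    rw [encard_Ioo_add hc.1 hc.2, hck] at hk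
    obtain ⟨d, hd, hdk⟩ := key c hc.2 (fun h => by simp [h] at hk)
    refine ⟨d, ⟨hc.1.trans hd.1, hd.2⟩, ?_⟩
    rw [encard_Ioo_add hc.1 hd.1, hck, hdk]
    simp

theorem IsDiscrete.exists_left (hP : IsDiscrete P) (k : ℕ) {a b : P} (hab : a < b)
    (hk : (k : ℕ∞) < (Set.Ioo a b).encard) : ∃ c ∈ Set.Ioo a b, (Set.Ioo c b).encard = k := by
  have key : ∀ c, a < c → (Set.Ioo a c).encard ≠ 0 →
      ∃ d ∈ Set.Ioo a c, (Set.Ioo d c).encard = 0 := by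
    intro c hc h
    obtain ⟨x, hx⟩ := Set.encard_ne_zero.1 h
    obtain ⟨d, hd, hd'⟩ := hP.pred a c hc
    refine ⟨d, ⟨hx.1.trans_le (hd' x hx.2), hd⟩, ?_⟩
    rw [Set.encard_eq_zero, Set.eq_empty_iff_forall_notMem]
    exact fun y hy => (hd' y hy.2).not_gt hy.1
  induction k with
  | zero => simpa using key b hab (fun h => by simp [h] at hk)
  | succ k ih =>
    obtain ⟨c, hc, hck⟩ := ih (lt_of_le_of_lt (by norm_cast; omega) hk)
    rw [encard_Ioo_add hc.1 hc.2, hck, add_assoc, add_comm 1] at hk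
    obtain ⟨d, hd, hdk⟩ := key c hc.1 (fun h => by simp [h] at hk)
    refine ⟨d, ⟨hd.1, hd.2.trans hc.2⟩, ?_⟩
    rw [encard_Ioo_add hd.2 hc.2, hck, hdk]
    simp [add_comm]

/-- A short side, with fewer than `t` points, is copied exactly, and `Close.cancel` takes care of
the other side. Only one side needs to be copied. -/
theorem Close.split {t : ℕ} (hQ : IsDiscrete Q) {a q a' : P} (h1 : a < q) (h2 : q < a') {b b' : Q}
    (hb : b < b') (h : Close (2 * t + 1) (Set.Ioo a a').encard (Set.Ioo b b').encard) :
    ∃ r ∈ Set.Ioo b b', Close t (Set.Ioo a q).encard (Set.Ioo b r).encard ∧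
      Close t (Set.Ioo q a').encard (Set.Ioo r b').encard := by
  rw [encard_Ioo_add h1 h2] at h
  generalize (Set.Ioo a q).encard = K at *
  generalize (Set.Ioo q a').encard = L at *
  rcases lt_or_ge K t with hK | hK
  · lift K to ℕ using hK.ne_top
    have hlt : (K : ℕ∞) < (Set.Ioo b b').encard := by
      rcases h with h | ⟨_, h⟩
      · rw [← h]
        cases L using ENat.recTopCoe
        · simp
        · norm_cast; omega
      · refine lt_of_lt_of_le ?_ h
        norm_cast at hK ⊢; omega
    obtain ⟨r, hr, hrK⟩ := hQ.exists_right K hb hlt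
    refine ⟨r, hr, .inl hrK.symm, ?_⟩
    rw [encard_Ioo_add hr.1 hr.2, hrK] at h
    exact h.cancel (by exact_mod_cast hK)
  rcases lt_or_ge L t with hL | hL
  · lift L to ℕ using hL.ne_top
    have hlt : (L : ℕ∞) < (Set.Ioo b b').encard := by
      rcases h with h | ⟨_, h⟩
      · rw [← h]
        cases K using ENat.recTopCoe
        · simp
        · norm_cast; omega
      · refine lt_of_lt_of_le ?_ h
        norm_cast at hL ⊢; omega
    obtain ⟨r, hr, hrK⟩ := hQ.exists_left L hb hlt
    refine ⟨r, hr, ?_, .inl hrK.symm⟩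
    rw [encard_Ioo_add hr.1 hr.2, hrK] at h
    have e : ∀ x y : ℕ∞, x + 1 + y = y + 1 + x := fun x y => by ring
    rw [e K, e _ (L : ℕ∞)] at h
    exact h.cancel (by exact_mod_cast hL)
  have hN : ((2 * t + 1 : ℕ) : ℕ∞) ≤ (Set.Ioo b b').encard := by
    rcases h with h | ⟨_, h⟩
    · rw [← h]
      push_cast
      rw [two_mul, add_assoc, add_assoc, add_comm (t : ℕ∞) 1]
      gcongr
    · exact h
  -- Both sides are long. A point with exactly `t` points to its left within the interval leaves at
  -- least `t` to its right, as `2 * t + 1 = t + 1 + t`.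
  obtain ⟨r, hr, hrK⟩ := hQ.exists_right t hb (lt_of_lt_of_le (by norm_cast; omega) hN)
  refine ⟨r, hr, .inr ⟨hK, hrK.ge⟩, .inr ⟨hL, ?_⟩⟩
  rw [encard_Ioo_add hr.1 hr.2, hrK] at hN
  generalize (Set.Ioo r b').encard = L' at *
  cases L' using ENat.recTopCoe
  · simp
  · norm_cast at *; omega

/-- The pairs of positions chosen so far include both endpoints, and corresponding distances agree
up to the threshold `t`. -/
structure DistInv (t : ℕ) (S : Set (P × Q)) : Prop where
  finite : S.Finite
  bot : ∃ x ∈ S, IsBot x.1 ∧ IsBot x.2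
  top : ∃ x ∈ S, IsTop x.1 ∧ IsTop x.2
  lt_iff : ∀ x ∈ S, ∀ y ∈ S, (x.1 < y.1 ↔ x.2 < y.2)
  close : ∀ x ∈ S, ∀ y ∈ S, x.1 < y.1 →
    Close t (Set.Ioo x.1 y.1).encard (Set.Ioo x.2 y.2).encard

theorem DistInv.eq_iff {t : ℕ} {S : Set (P × Q)} (h : DistInv t S) {x y : P × Q} (hx : x ∈ S)
    (hy : y ∈ S) : x.1 = y.1 ↔ x.2 = y.2 := by
  have h1 := h.lt_iff x hx y hy
  have h2 := h.lt_iff y hy x hx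
  rw [← not_iff_not, ← ne_eq, ← ne_eq, lt_or_lt_iff_ne.symm, lt_or_lt_iff_ne.symm, h1, h2]

theorem DistInv.symm {t : ℕ} {S : Set (P × Q)} (h : DistInv t S) :
    DistInv t (Prod.swap '' S) where
  finite := h.finite.image _
  bot := by
    obtain ⟨x, hx, h1, h2⟩ := h.bot
    exact ⟨x.swap, Set.mem_image_of_mem _ hx, h2, h1⟩
  top := by
    obtain ⟨x, hx, h1, h2⟩ := h.top
    exact ⟨x.swap, Set.mem_image_of_mem _ hx, h2, h1⟩
  lt_iff := by
    rintro _ ⟨x, hx, rfl⟩ _ ⟨y, hy, rfl⟩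
    exact (h.lt_iff x hx y hy).symm
  close := by
    rintro _ ⟨x, hx, rfl⟩ _ ⟨y, hy, rfl⟩ hlt
    exact (h.close x hx y hy ((h.lt_iff x hx y hy).2 hlt)).symm

theorem DistInv.insert {t : ℕ} {S : Set (P × Q)} (h : DistInv t S) {a : P} {b : Q}
    (hl : ∀ z ∈ S, z.1 < a → z.2 < b ∧ Close t (Set.Ioo z.1 a).encard (Set.Ioo z.2 b).encard)
    (hr : ∀ z ∈ S, a < z.1 → b < z.2 ∧ Close t (Set.Ioo a z.1).encard (Set.Ioo b z.2).encard)
    (he : ∀ z ∈ S, z.1 ≠ a) : DistInv t (insert (a, b) S) where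
  finite := h.finite.insert _
  bot := by
    obtain ⟨x, hx, hx'⟩ := h.bot
    exact ⟨x, Set.mem_insert_of_mem _ hx, hx'⟩
  top := by
    obtain ⟨x, hx, hx'⟩ := h.top
    exact ⟨x, Set.mem_insert_of_mem _ hx, hx'⟩
  lt_iff := by
    rintro x (rfl | hx) y (rfl | hy)
    · simp
    · rcases lt_or_gt_of_ne (he y hy) with hlt | hlt
      · simp [hlt.not_gt, (hl y hy hlt).1.le]
      · simp [hlt, (hr y hy hlt).1]
    · rcases lt_or_gt_of_ne (he x hx) with hlt | hlt
      · simp [hlt, (hl x hx hlt).1]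
      · simp [hlt.not_gt, (hr x hx hlt).1.le]
    · exact h.lt_iff x hx y hy
  close := by
    rintro x (rfl | hx) y (rfl | hy) hlt
    · exact (lt_irrefl _ hlt).elim
    · exact (hr y hy hlt).2
    · exact (hl x hx hlt).2
    · exact h.close x hx y hy hlt

/-- A new point lies between two neighbouring chosen points, which exist because both endpoints are
chosen. The reply splits the corresponding interval; distances to points further away pass through
the neighbours and are added up by `Close.add`. -/
theorem DistInv.forth {t : ℕ} (hQ : IsDiscrete Q) {S : Set (P × Q)} (h : DistInv (2 * t + 1) S)
    (a : P) : ∃ b, DistInv t (Insert.insert (a, b) S) := by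
  have h' : DistInv t S := { h with close := fun x hx y hy hlt => (h.close x hx y hy hlt).mono (by omega) }
  by_cases ha : ∃ x ∈ S, x.1 = a
  · obtain ⟨x, hx, rfl⟩ := ha
    exact ⟨x.2, by rwa [Set.insert_eq_of_mem hx]⟩
  push Not at ha
  have hL : ({x ∈ S | x.1 < a} : Set (P × Q)).Nonempty := by
    obtain ⟨x, hx, h1, -⟩ := h.bot
    exact ⟨x, hx, lt_of_le_of_ne (h1 a) (ha x hx)⟩
  have hR : ({x ∈ S | a < x.1} : Set (P × Q)).Nonempty := by
    obtain ⟨x, hx, h1, -⟩ := h.top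
    exact ⟨x, hx, lt_of_le_of_ne (h1 a) (ha x hx).symm⟩
  obtain ⟨x, ⟨hx, hxa⟩, hxm⟩ := Set.exists_max_image _ Prod.fst (h.finite.subset (Set.sep_subset _ _)) hL
  obtain ⟨y, ⟨hy, hya⟩, hym⟩ := Set.exists_min_image _ Prod.fst (h.finite.subset (Set.sep_subset _ _)) hR
  obtain ⟨r, hr, h1, h2⟩ := (h.close x hx y hy (hxa.trans hya)).split hQ hxa hya
    ((h.lt_iff x hx y hy).1 (hxa.trans hya))
  refine ⟨r, h'.insert ?_ ?_ ha⟩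
  · intro z hz hza
    rcases (hxm z ⟨hz, hza⟩).lt_or_eq with hlt | heq
    · have hlt' := (h.lt_iff z hz x hx).1 hlt
      refine ⟨hlt'.trans hr.1, ?_⟩
      rw [encard_Ioo_add hlt hxa, encard_Ioo_add hlt' hr.1]
      exact (h'.close z hz x hx hlt).add h1
    · rw [heq, (h.eq_iff hz hx).1 heq]
      exact ⟨hr.1, h1⟩
  · intro z hz hza
    rcases (hym z ⟨hz, hza⟩).lt_or_eq with hlt | heq
    · have hlt' := (h.lt_iff y hy z hz).1 hlt
      refine ⟨hr.2.trans hlt', ?_⟩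
      rw [encard_Ioo_add hya hlt, encard_Ioo_add hr.2 hlt']
      exact h2.add (h'.close y hy z hz hlt)
    · rw [← heq, ← (h.eq_iff hy hz).1 heq]
      exact ⟨hr.2, h2⟩

/-- The threshold `2 ^ n - 1` solves the recursion `t ↦ 2 * t + 1` of `DistInv.forth` with initial
value `0`. -/
theorem DistInv.bf (hP : IsDiscrete P) (hQ : IsDiscrete Q) (n : ℕ) {S : Set (P × Q)}
    (h : DistInv (2 ^ n - 1) S) : BF (fun _ => ()) (fun _ => ()) n S := by
  induction n generalizing S with
  | zero => exact fun x hx => ⟨rfl, fun y hy => h.lt_iff x hx y hy⟩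
  | succ n ih =>
    have e : 2 ^ (n + 1) - 1 = 2 * (2 ^ n - 1) + 1 := by
      have := Nat.one_le_two_pow (n := n)
      omega
    rw [e] at h
    refine ⟨fun a => ?_, fun b => ?_⟩
    · obtain ⟨b, hb⟩ := h.forth hQ a
      exact ⟨b, ih hb⟩
    · obtain ⟨a, ha⟩ := h.symm.forth hP b
      refine ⟨a, ih ?_⟩
      have := ha.symm
      rwa [Set.image_insert_eq, Set.image_image, Set.image_congr (fun x _ => Prod.swap_swap x),
        Set.image_id'] at this

end Distance
/-! ### The linear order `ϱ` -/

section Rho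

/-- The positions of the initial part `ω` of `ϱ`. -/
def rhoInit (m : ℕ) : Rho := toLex (Sum.inl (toLex (Sum.inl m)))

/-- The positions of the middle part `ζ·η` of `ϱ`. -/
def rhoMid (q : ℚ) (z : ℤ) : Rho := toLex (Sum.inl (toLex (Sum.inr (toLex (q, z)))))

/-- The positions of the final part `ω*` of `ϱ`. -/
def rhoFinal (k : ℕ) : Rho := toLex (Sum.inr (OrderDual.toDual k))

theorem rho_cases (a : Rho) :
    (∃ m, a = rhoInit m) ∨ (∃ q z, a = rhoMid q z) ∨ ∃ k, a = rhoFinal k := by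
  rcases a with (m | ⟨q, z⟩) | k
  · exact .inl ⟨m, rfl⟩
  · exact .inr (.inl ⟨q, z, rfl⟩)
  · exact .inr (.inr ⟨k, rfl⟩)

@[simp] theorem rhoInit_lt_rhoInit {m m' : ℕ} : rhoInit m < rhoInit m' ↔ m < m' := by
  simp [rhoInit]

@[simp] theorem rhoInit_lt_rhoMid {m : ℕ} {q : ℚ} {z : ℤ} : rhoInit m < rhoMid q z := by
  simp [rhoInit, rhoMid]

@[simp] theorem rhoInit_lt_rhoFinal {m k : ℕ} : rhoInit m < rhoFinal k := by
  simp [rhoInit, rhoFinal]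

@[simp] theorem rhoMid_lt_rhoInit {m : ℕ} {q : ℚ} {z : ℤ} : ¬ rhoMid q z < rhoInit m := by
  simp [rhoInit, rhoMid]

@[simp] theorem rhoMid_lt_rhoMid {q q' : ℚ} {z z' : ℤ} :
    rhoMid q z < rhoMid q' z' ↔ q < q' ∨ q = q' ∧ z < z' := by
  simp [rhoMid, Prod.Lex.toLex_lt_toLex]

@[simp] theorem rhoMid_lt_rhoFinal {q : ℚ} {z : ℤ} {k : ℕ} : rhoMid q z < rhoFinal k := by
  simp [rhoMid, rhoFinal]

@[simp] theorem rhoFinal_lt_rhoInit {m k : ℕ} : ¬ rhoFinal k < rhoInit m := by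
  simp [rhoInit, rhoFinal]

@[simp] theorem rhoFinal_lt_rhoMid {q : ℚ} {z : ℤ} {k : ℕ} : ¬ rhoFinal k < rhoMid q z := by
  simp [rhoMid, rhoFinal]

@[simp] theorem rhoFinal_lt_rhoFinal {k k' : ℕ} : rhoFinal k < rhoFinal k' ↔ k' < k := by
  simp [rhoFinal]

theorem isBot_rhoInit_zero : IsBot (rhoInit 0) := by
  intro a
  rw [← not_lt]
  obtain ⟨m, rfl⟩ | ⟨q, z, rfl⟩ | ⟨k, rfl⟩ := rho_cases a <;> simp

theorem isTop_rhoFinal_zero : IsTop (rhoFinal 0) := by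
  intro a
  rw [← not_lt]
  obtain ⟨m, rfl⟩ | ⟨q, z, rfl⟩ | ⟨k, rfl⟩ := rho_cases a <;> simp

theorem isDiscrete_rho : IsDiscrete Rho where
  succ a b hab := by
    obtain ⟨m, rfl⟩ | ⟨q, z, rfl⟩ | ⟨k, rfl⟩ := rho_cases a
    · refine ⟨rhoInit (m + 1), by simp, fun d hd => ?_⟩
      rw [← not_lt]
      obtain ⟨m', rfl⟩ | ⟨q', z', rfl⟩ | ⟨k', rfl⟩ := rho_cases d <;> simp at * <;> omega
    · refine ⟨rhoMid q (z + 1), by simp, fun d hd => ?_⟩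
      rw [← not_lt]
      obtain ⟨m', rfl⟩ | ⟨q', z', rfl⟩ | ⟨k', rfl⟩ := rho_cases d
      · simp at hd
      · simp only [rhoMid_lt_rhoMid] at *
        rintro (h | ⟨rfl, h⟩) <;> rcases hd with hd | ⟨hd, hd'⟩
        · exact lt_asymm h hd
        · exact h.ne' hd
        · exact lt_irrefl _ hd
        · omega
      · simp
    · cases k with
      | zero => exact ((isTop_rhoFinal_zero b).not_gt hab).elim
      | succ k =>
        refine ⟨rhoFinal k, by simp, fun d hd => ?_⟩
        rw [← not_lt]
        obtain ⟨m', rfl⟩ | ⟨q', z', rfl⟩ | ⟨k', rfl⟩ := rho_cases d <;> simp at * <;> omega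
  pred a b hab := by
    obtain ⟨m, rfl⟩ | ⟨q, z, rfl⟩ | ⟨k, rfl⟩ := rho_cases b
    · cases m with
      | zero => exact ((isBot_rhoInit_zero a).not_gt hab).elim
      | succ m =>
        refine ⟨rhoInit m, by simp, fun d hd => ?_⟩
        rw [← not_lt]
        obtain ⟨m', rfl⟩ | ⟨q', z', rfl⟩ | ⟨k', rfl⟩ := rho_cases d <;> simp at * <;> omega
    · refine ⟨rhoMid q (z - 1), by simp, fun d hd => ?_⟩
      rw [← not_lt]
      obtain ⟨m', rfl⟩ | ⟨q', z', rfl⟩ | ⟨k', rfl⟩ := rho_cases d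
      · simp
      · simp only [rhoMid_lt_rhoMid] at *
        rintro (h | ⟨rfl, h⟩) <;> rcases hd with hd | ⟨hd, hd'⟩
        · exact lt_asymm h hd
        · exact h.ne' hd
        · exact lt_irrefl _ hd
        · omega
      · simp at hd
    · refine ⟨rhoFinal (k + 1), by simp, fun d hd => ?_⟩
      rw [← not_lt]
      obtain ⟨m', rfl⟩ | ⟨q', z', rfl⟩ | ⟨k', rfl⟩ := rho_cases d <;> simp at * <;> omega

theorem infinite_Ioo_rhoInit_rhoMid (m : ℕ) (q : ℚ) (z : ℤ) :
    (Set.Ioo (rhoInit m) (rhoMid q z)).Infinite :=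
  Set.infinite_of_injective_forall_mem (f := fun i : ℕ => rhoInit (m + 1 + i))
    (StrictMono.injective fun i j h => by simpa) (fun i => by simp; omega)

theorem infinite_Ioo_rhoMid_rhoMid {q q' : ℚ} (h : q < q') (z z' : ℤ) :
    (Set.Ioo (rhoMid q z) (rhoMid q' z')).Infinite :=
  Set.infinite_of_injective_forall_mem (f := fun i : ℕ => rhoMid q (z + 1 + i))
    (StrictMono.injective fun i j h => by simpa) (fun i => by simp [h]; omega)

theorem infinite_Ioo_rhoMid_rhoFinal (q : ℚ) (z : ℤ) (k : ℕ) :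
    (Set.Ioo (rhoMid q z) (rhoFinal k)).Infinite :=
  Set.infinite_of_injective_forall_mem (f := fun i : ℕ => rhoMid q (z + 1 + i))
    (StrictMono.injective fun i j h => by simpa) (fun i => by simp; omega)

/-- An interval inside `ω`, inside `ω*` or inside one copy of `ζ` is finite. Any other one contains
an entire copy of `ζ`, since `ℚ` is dense without endpoints, and each point of that copy will do. -/
theorem exists_infinite_Ioo_rho {a b : Rho} (h : (Set.Ioo a b).Infinite) :
    ∃ r ∈ Set.Ioo a b, (Set.Ioo a r).Infinite ∧ (Set.Ioo r b).Infinite := by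
  obtain ⟨x, hx⟩ := h.nonempty
  have hab := hx.1.trans hx.2
  obtain ⟨m, rfl⟩ | ⟨q, z, rfl⟩ | ⟨k, rfl⟩ := rho_cases a <;>
    obtain ⟨m', rfl⟩ | ⟨q', z', rfl⟩ | ⟨k', rfl⟩ := rho_cases b
  · refine (h (((Set.finite_Iio m').image rhoInit).subset fun c hc => ?_)).elim
    obtain ⟨i, rfl⟩ | ⟨q, z, rfl⟩ | ⟨k, rfl⟩ := rho_cases c <;> simp at hc ⊢
    exact ⟨i, hc.2, rfl⟩
  · exact ⟨rhoMid (q' - 1) 0, by simp, infinite_Ioo_rhoInit_rhoMid _ _ _,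
      infinite_Ioo_rhoMid_rhoMid (by simp) _ _⟩
  · exact ⟨rhoMid 0 0, by simp, infinite_Ioo_rhoInit_rhoMid _ _ _,
      infinite_Ioo_rhoMid_rhoFinal _ _ _⟩
  · simp at hab
  · simp only [rhoMid_lt_rhoMid] at hab
    rcases hab with hq | ⟨rfl, hz⟩
    · obtain ⟨p, hp, hp'⟩ := exists_between hq
      exact ⟨rhoMid p 0, by simp [hp, hp'], infinite_Ioo_rhoMid_rhoMid hp _ _,
        infinite_Ioo_rhoMid_rhoMid hp' _ _⟩
    · refine (h (((Set.finite_Ioo z z').image (rhoMid q)).subset fun c hc => ?_)).elim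
      obtain ⟨i, rfl⟩ | ⟨p, i, rfl⟩ | ⟨k, rfl⟩ := rho_cases c
      · simp at hc
      · simp only [Set.mem_Ioo, rhoMid_lt_rhoMid] at hc
        obtain ⟨h1 | ⟨rfl, h1⟩, h2 | ⟨h2, h2'⟩⟩ := hc
        · exact (lt_asymm h1 h2).elim
        · exact (h1.ne' h2).elim
        · exact (lt_irrefl _ h2).elim
        · exact ⟨i, ⟨h1, h2'⟩, rfl⟩
      · simp at hc
  · exact ⟨rhoMid (q + 1) 0, by simp, infinite_Ioo_rhoMid_rhoMid (by simp) _ _,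
      infinite_Ioo_rhoMid_rhoFinal _ _ _⟩
  · simp at hab
  · simp at hab
  · refine (h (((Set.finite_Iio k).image rhoFinal).subset fun c hc => ?_)).elim
    obtain ⟨i, rfl⟩ | ⟨p, i, rfl⟩ | ⟨i, rfl⟩ := rho_cases c <;> simp at hc ⊢
    exact ⟨i, hc.1, rfl⟩

theorem isDiscrete_fin (m : ℕ) : IsDiscrete (Fin m) where
  succ a b hab := ⟨⟨a + 1, by omega⟩, by simp [Fin.lt_def], fun d hd => by
    simp only [Fin.lt_def, Fin.le_def] at *; omega⟩
  pred a b hab := ⟨⟨b - 1, by omega⟩, by simp only [Fin.lt_def] at *; omega, fun d hd => by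
    simp only [Fin.lt_def, Fin.le_def] at *; omega⟩

/-- The distance game starts with the pairs of endpoints. There are `m - 1 ≥ 2 ^ n - 1` points
strictly between those of `Fin (m + 1)`, and infinitely many between those of `ϱ`. -/
theorem bf_fin_rho (n m : ℕ) (hm : 2 ^ n ≤ m) :
    BF (fun _ : Fin (m + 1) => ()) (fun _ : Rho => ()) n ∅ := by
  have hlt : (0 : Fin (m + 1)) < Fin.last m :=
    Fin.lt_def.2 (by have := Nat.one_le_two_pow (n := n); simp; omega)
  refine BF.mono (DistInv.bf (isDiscrete_fin _) isDiscrete_rho n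
    (S := {(0, rhoInit 0), (Fin.last m, rhoFinal 0)}) ?_) (Set.empty_subset _)
  have hc : Close (2 ^ n - 1) (Set.Ioo (0 : Fin (m + 1)) (Fin.last m)).encard
      (Set.Ioo (rhoInit 0) (rhoFinal 0)).encard := by
    right
    constructor
    · rw [Set.encard_eq_coe_toFinset_card]
      simp
      norm_cast
      omega
    · rw [((infinite_Ioo_rhoInit_rhoMid 0 0 0).mono
        (Set.Ioo_subset_Ioo_right (le_of_lt (by simp)))).encard_eq]
      exact le_top
  refine ⟨by simp, ⟨_, .inl rfl, Fin.zero_le, isBot_rhoInit_zero⟩,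
    ⟨_, .inr rfl, Fin.le_last, isTop_rhoFinal_zero⟩, ?_, ?_⟩
  · rintro x (rfl | rfl) y (rfl | rfl) <;> simp [hlt]
  · rintro x (rfl | rfl) y (rfl | rfl) h
    · exact (lt_irrefl _ h).elim
    · exact hc
    · exact (lt_asymm hlt h).elim
    · exact (lt_irrefl _ h).elim

end Rho
/-! ### Saturated labelled orders -/

section Saturation

universe u
variable {Λ : Type u} {P Q T : Type*} [LinearOrder P] [LinearOrder Q] [LinearOrder T]

/-- The diagonal of `A`. -/
def diag (A : Set P) : Set (P × P) := {x | x.1 ∈ A ∧ x.2 = x.1}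

/-- Every type over finitely many parameters is realized; types are given by ultrafilters. -/
def Saturated (f : P → Λ) : Prop :=
  ∀ A : Set P, A.Finite → ∀ U : Ultrafilter P, ∃ r, ∀ n, ∀ᶠ r' in (U : Filter P),
    BF f f n (insert (r, r') (diag A))

theorem exists_eq_of_mem_diag {X : Type*} {A : Set X} {x : X × X} (hx : x ∈ diag A) : ∃ c ∈ A, x = (c, c) :=
  ⟨x.1, hx.1, Prod.ext rfl hx.2⟩

theorem BF.of_diag (f : P → Λ) (n : ℕ) (A : Set P) : BF f f n (diag A) := BF.refl fun _ hx => hx.2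

theorem BF.insert_diag_self {f : P → Λ} (n : ℕ) (r : P) (A : Set P) :
    BF f f n (insert (r, r) (diag A)) := by
  refine BF.refl ?_
  rintro x (rfl | hx)
  · rfl
  · exact hx.2

/-- Among `n + 1` points above `a`, the largest has `n` others between `a` and itself. So only
finitely many points above `a` fail the bound, and a non-principal ultrafilter ignores them. -/
theorem eventually_le_encard_Ioo_right {U : Ultrafilter P} (hU : ∀ r, U ≠ pure r) {a : P}
    (ha : Set.Ioi a ∈ U) (n : ℕ) : ∀ᶠ r in (U : Filter P), (n : ℕ∞) ≤ (Set.Ioo a r).encard := by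
  by_contra hcon
  have h1 : {r | ¬ (n : ℕ∞) ≤ (Set.Ioo a r).encard} ∩ Set.Ioi a ∈ U :=
    Filter.inter_mem (Ultrafilter.compl_mem_iff_notMem.2 hcon) ha
  refine (Ultrafilter.eq_pure_of_finite_mem ?_ h1).elim fun r hr => hU r hr.2
  by_contra hinf
  obtain ⟨s, hs, hcard⟩ := Set.Infinite.exists_subset_card_eq hinf (n + 1)
  have hne : s.Nonempty := Finset.card_pos.1 (by omega)
  refine (hs (s.max'_mem hne)).1 ?_
  have hsub : (↑(s.erase (s.max' hne)) : Set P) ⊆ Set.Ioo a (s.max' hne) := fun x hx => by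
    have hx' : x ∈ s.erase (s.max' hne) := hx
    exact ⟨(hs (Finset.mem_of_mem_erase hx')).2, s.lt_max'_of_mem_erase_max' hne hx'⟩
  refine le_trans ?_ (Set.encard_le_encard hsub)
  rw [Set.encard_coe_eq_coe_finsetCard, Finset.card_erase_of_mem (s.max'_mem hne), hcard]
  simp

theorem eventually_le_encard_Ioo_left {U : Ultrafilter P} (hU : ∀ r, U ≠ pure r) {a : P}
    (ha : Set.Iio a ∈ U) (n : ℕ) : ∀ᶠ r in (U : Filter P), (n : ℕ∞) ≤ (Set.Ioo r a).encard := by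
  by_contra hcon
  have h1 : {r | ¬ (n : ℕ∞) ≤ (Set.Ioo r a).encard} ∩ Set.Iio a ∈ U :=
    Filter.inter_mem (Ultrafilter.compl_mem_iff_notMem.2 hcon) ha
  refine (Ultrafilter.eq_pure_of_finite_mem ?_ h1).elim fun r hr => hU r hr.2
  by_contra hinf
  obtain ⟨s, hs, hcard⟩ := Set.Infinite.exists_subset_card_eq hinf (n + 1)
  have hne : s.Nonempty := Finset.card_pos.1 (by omega)
  refine (hs (s.min'_mem hne)).1 ?_
  have hsub : (↑(s.erase (s.min' hne)) : Set P) ⊆ Set.Ioo (s.min' hne) a := fun x hx => by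
    have hx' : x ∈ s.erase (s.min' hne) := hx
    exact ⟨s.min'_lt_of_mem_erase_min' hne hx', (hs (Finset.mem_of_mem_erase hx')).2⟩
  refine le_trans ?_ (Set.encard_le_encard hsub)
  rw [Set.encard_coe_eq_coe_finsetCard, Finset.card_erase_of_mem (s.min'_mem hne), hcard]
  simp

/-- A non-principal ultrafilter concentrates on an interval between neighbouring parameters `a` and
`b`, and its points are eventually further from both than any given finite distance. A point
infinitely far from `a` and `b` therefore realizes its type, for all `n` simultaneously. -/
theorem saturated_of_discrete (hP : IsDiscrete P) {bot top : P} (hbot : IsBot bot)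
    (htop : IsTop top) (hsplit : ∀ a b : P, (Set.Ioo a b).Infinite →
      ∃ r ∈ Set.Ioo a b, (Set.Ioo a r).Infinite ∧ (Set.Ioo r b).Infinite) :
    Saturated (fun _ : P => ()) := by
  intro A₀ hA₀ U
  by_cases hU : ∃ r, U = pure r
  · obtain ⟨r, rfl⟩ := hU
    exact ⟨r, fun n => by simpa using BF.insert_diag_self n r A₀⟩
  push Not at hU
  -- The endpoints are added as parameters because `DistInv` requires them.
  obtain ⟨A, hA, hsub, hb, ht⟩ : ∃ A : Set P, A.Finite ∧ A₀ ⊆ A ∧ bot ∈ A ∧ top ∈ A :=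
    ⟨insert bot (insert top A₀), (hA₀.insert _).insert _, fun x hx => by simp [hx], by simp, by simp⟩
  have hLR : ∀ a, Set.Ioi a ∈ U ∨ Set.Iio a ∈ U := by
    intro a
    rw [← Ultrafilter.union_mem_iff]
    by_contra h
    refine (Ultrafilter.eq_pure_of_finite_mem (Set.finite_singleton a) ?_).elim
      fun r hr => hU r hr.2
    rw [← Ultrafilter.compl_mem_iff_notMem] at h
    refine Filter.mem_of_superset h fun x hx => ?_
    simp only [Set.mem_compl_iff, Set.mem_union, Set.mem_Ioi, Set.mem_Iio, not_or, not_lt] at hx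
    exact le_antisymm hx.1 hx.2
  have hbL : Set.Ioi bot ∈ U := (hLR bot).resolve_right fun h => by
    obtain ⟨x, hx⟩ := U.nonempty_of_mem h
    exact (hbot x).not_gt hx
  have htR : Set.Iio top ∈ U := (hLR top).resolve_left fun h => by
    obtain ⟨x, hx⟩ := U.nonempty_of_mem h
    exact (htop x).not_gt hx
  obtain ⟨a, ⟨haA, ha⟩, hamax⟩ := Set.exists_max_image {a ∈ A | Set.Ioi a ∈ U} id
    (hA.subset (Set.sep_subset _ _)) ⟨bot, hb, hbL⟩
  obtain ⟨b, ⟨hbA, hb'⟩, hbmin⟩ := Set.exists_min_image {a ∈ A | Set.Iio a ∈ U} id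
    (hA.subset (Set.sep_subset _ _)) ⟨top, ht, htR⟩
  have hab : Set.Ioo a b ∈ U := Filter.inter_mem ha hb'
  obtain ⟨r, hr, har, hrb⟩ := hsplit a b fun hfin =>
    (Ultrafilter.eq_pure_of_finite_mem hfin hab).elim fun r hr => hU r hr.2
  refine ⟨r, fun n => ?_⟩
  filter_upwards [hab, eventually_le_encard_Ioo_right hU ha (2 ^ n - 1),
    eventually_le_encard_Ioo_left hU hb' (2 ^ n - 1)] with r' hr' h1 h2
  have hcase : ∀ c ∈ A, c ≤ a ∨ b ≤ c := fun c hc =>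
    (hLR c).imp (fun h => hamax c ⟨hc, h⟩) fun h => hbmin c ⟨hc, h⟩
  have hdiag : DistInv (2 ^ n - 1) (diag A) := by
    refine ⟨?_, ⟨(bot, bot), ⟨hb, rfl⟩, hbot, hbot⟩, ⟨(top, top), ⟨ht, rfl⟩, htop, htop⟩, ?_, ?_⟩
    · refine (hA.image fun c => (c, c)).subset ?_
      rintro _ hx
      obtain ⟨c, hc, rfl⟩ := exists_eq_of_mem_diag hx
      exact ⟨c, hc, rfl⟩
    · intro x hx y hy
      rw [hx.2, hy.2]
    · intro x hx y hy _
      rw [hx.2, hy.2]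
      exact .inl rfl
  refine BF.mono (DistInv.bf hP hP n (hdiag.insert (a := r) (b := r') ?_ ?_ ?_))
    (Set.insert_subset_insert fun x hx => ⟨hsub hx.1, hx.2⟩)
  · rintro ⟨c, d⟩ ⟨hc, hd⟩ hlt
    obtain rfl : d = c := hd
    have hca : d ≤ a := (hcase d hc).resolve_right fun h => (hr.2.trans_le h).not_gt hlt
    refine ⟨hca.trans_lt hr'.1, .inr ⟨?_, ?_⟩⟩
    · rw [(har.mono (Set.Ioo_subset_Ioo_left hca)).encard_eq]
      exact le_top
    · exact h1.trans (Set.encard_le_encard (Set.Ioo_subset_Ioo_left hca))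
  · rintro ⟨c, d⟩ ⟨hc, hd⟩ hlt
    obtain rfl : d = c := hd
    have hca : b ≤ d := (hcase d hc).resolve_left fun h => (h.trans_lt hr.1).not_gt hlt
    refine ⟨hr'.2.trans_le hca, .inr ⟨?_, ?_⟩⟩
    · rw [(hrb.mono (Set.Ioo_subset_Ioo_right hca)).encard_eq]
      exact le_top
    · exact h2.trans (Set.encard_le_encard (Set.Ioo_subset_Ioo_right hca))
  · rintro ⟨c, d⟩ ⟨hc, hd⟩ heq
    obtain rfl : c = r := heq
    exact (hcase c hc).elim hr.1.not_ge hr.2.not_ge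

theorem saturated_rho : Saturated (fun _ : Rho => ()) :=
  saturated_of_discrete isDiscrete_rho isBot_rhoInit_zero isTop_rhoFinal_zero
    fun _ _ => exists_infinite_Ioo_rho

theorem Saturated.of_subsingleton [Subsingleton P] [Nonempty P] (f : P → Λ) : Saturated f := by
  intro A _ U
  refine ⟨Classical.arbitrary P, fun n => .of_forall fun r => ?_⟩
  rw [Subsingleton.elim r]
  exact BF.insert_diag_self _ _ _

/-- The ultrafilter lives on one of the summands, where the type is realized; the other summand is
matched with itself. -/
theorem Saturated.sum {f : P → Λ} {g : Q → Λ} (hf : Saturated f) (hg : Saturated g) :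
    Saturated (fun i : P ⊕ₗ Q => Sum.elim f g (ofLex i)) := by
  intro A hA U
  have hl : Function.Injective fun i : P => (toLex (Sum.inl i) : P ⊕ₗ Q) :=
    toLex.injective.comp Sum.inl_injective
  have hr : Function.Injective fun i : Q => (toLex (Sum.inr i) : P ⊕ₗ Q) :=
    toLex.injective.comp Sum.inr_injective
  have hdiag : diag A ⊆ sumPairs (diag {i | toLex (Sum.inl i) ∈ A})
      (diag {i | toLex (Sum.inr i) ∈ A}) := by
    rintro ⟨x, y⟩ ⟨hx, hy⟩
    obtain rfl : y = x := hy
    rcases y with i | i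
    · exact .inl ⟨i, i, ⟨hx, rfl⟩, rfl⟩
    · exact .inr ⟨i, i, ⟨hx, rfl⟩, rfl⟩
  have hU : (Set.range fun i : P => (toLex (Sum.inl i) : P ⊕ₗ Q)) ∈ U ∨
      (Set.range fun i : Q => (toLex (Sum.inr i) : P ⊕ₗ Q)) ∈ U := by
    rw [← Ultrafilter.union_mem_iff]
    refine Filter.mem_of_superset Filter.univ_mem fun x _ => ?_
    rcases x with i | i
    · exact .inl ⟨i, rfl⟩
    · exact .inr ⟨i, rfl⟩
  rcases hU with hU | hU
  · obtain ⟨r, hr⟩ := hf _ (hA.preimage hl.injOn) (U.comap hl hU)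
    refine ⟨toLex (Sum.inl r), fun n => ?_⟩
    obtain ⟨s, hs, hsub⟩ := Filter.mem_comap.1 (hr n)
    filter_upwards [hs, hU]
    rintro _ hx ⟨i, rfl⟩
    refine ((hsub hx).sum (BF.of_diag g n {i | toLex (Sum.inr i) ∈ A})).mono (Set.insert_subset ?_ ?_)
    · exact .inl ⟨r, i, Set.mem_insert _ _, rfl⟩
    · refine hdiag.trans ?_
      rintro x (⟨a, b, h, rfl⟩ | h)
      · exact .inl ⟨a, b, Set.mem_insert_of_mem _ h, rfl⟩
      · exact .inr h
  · obtain ⟨r, hr⟩ := hg _ (hA.preimage hr.injOn) (U.comap hr hU)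
    refine ⟨toLex (Sum.inr r), fun n => ?_⟩
    obtain ⟨s, hs, hsub⟩ := Filter.mem_comap.1 (hr n)
    filter_upwards [hs, hU]
    rintro _ hx ⟨i, rfl⟩
    refine (BF.sum (BF.of_diag f n {i | toLex (Sum.inl i) ∈ A}) (hsub hx)).mono
      (Set.insert_subset ?_ ?_)
    · exact .inr ⟨r, i, Set.mem_insert _ _, rfl⟩
    · refine hdiag.trans ?_
      rintro x (h | ⟨a, b, h, rfl⟩)
      · exact .inl h
      · exact .inr ⟨a, b, Set.mem_insert_of_mem _ h, rfl⟩

theorem Saturated.prod {f : P → Λ} (hT : Saturated (fun _ : T => ())) (hf : Saturated f) :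
    Saturated (fun i : T ×ₗ P => f (ofLex i).2) := by
  classical
  intro A hA U
  by_cases hU : ∃ t, {x : T ×ₗ P | (ofLex x).1 = t} ∈ U
  -- The ultrafilter lives on one copy of `P`: its type is realized there over the parameters of
  -- this copy, and all other positions are matched with themselves.
  · obtain ⟨t, ht⟩ := hU
    obtain ⟨r, hr⟩ := hf {i | toLex (t, i) ∈ A} (hA.preimage (f := fun i : P => toLex (t, i))
      (fun i _ j _ h => by simpa using h)) (U.map fun x => (ofLex x).2)
    refine ⟨toLex (t, r), fun n => ?_⟩
    filter_upwards [ht, Filter.mem_map.1 (hr n)] with y hy hbf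
    refine (BF.prod (S := diag Set.univ) (F := fun s s' => if s = t ∧ s' = t then
      insert (r, (ofLex y).2) (diag {i | toLex (t, i) ∈ A}) else diag Set.univ)
      (BF.of_diag _ n _) (fun s s' => ?_)).mono (Set.insert_subset ?_ ?_)
    · split_ifs
      · exact hbf
      · exact BF.of_diag f n _
    · exact ⟨⟨trivial, hy⟩, by simp [show (ofLex y).1 = t from hy]⟩
    · rintro ⟨⟨s, i⟩, y⟩ ⟨hx, hy⟩
      obtain rfl : y = (s, i) := hy
      refine ⟨⟨trivial, rfl⟩, ?_⟩
      dsimp only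
      split_ifs with h
      · obtain rfl : s = t := h.1
        exact .inr ⟨hx, rfl⟩
      · exact ⟨trivial, rfl⟩
  -- Eventually the index differs from those of all parameters. The copy is thus free of parameters,
  -- so index and inner position can be realized separately, the latter over no parameters.
  · push Not at hU
    have hA' : ((fun x : T ×ₗ P => (ofLex x).1) '' A).Finite := hA.image _
    obtain ⟨t, ht⟩ := hT _ hA' (U.map fun x => (ofLex x).1)
    obtain ⟨r, hr⟩ := hf ∅ Set.finite_empty (U.map fun x => (ofLex x).2)
    refine ⟨toLex (t, r), fun n => ?_⟩
    have hev : ∀ᶠ y in (U : Filter (T ×ₗ P)), ∀ s ∈ (fun x : T ×ₗ P => (ofLex x).1) '' A,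
        (ofLex y).1 ≠ s :=
      (Filter.eventually_all_finite hA').2 fun s _ =>
        Ultrafilter.compl_mem_iff_notMem.2 (hU s)
    filter_upwards [hev, Filter.mem_map.1 (ht n), Filter.mem_map.1 (hr n)] with y hy h1 h2
    refine (BF.prod (F := fun s s' => if s = t ∧ s' = (ofLex y).1 then
      insert (r, (ofLex y).2) (diag ∅) else diag Set.univ) h1 (fun s s' => ?_)).mono
      (Set.insert_subset ?_ ?_)
    · split_ifs
      · exact h2
      · exact BF.of_diag f n _
    · exact ⟨Set.mem_insert _ _, by simp⟩
    · rintro ⟨⟨s, i⟩, z⟩ ⟨hx, hz⟩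
      obtain rfl : z = (s, i) := hz
      have hs : s ∈ (fun x : T ×ₗ P => (ofLex x).1) '' A := ⟨_, hx, rfl⟩
      refine ⟨.inr ⟨hs, rfl⟩, ?_⟩
      dsimp only
      rw [if_neg fun h => hy s hs h.2.symm]
      exact ⟨trivial, rfl⟩

theorem PiTerm.saturated_rhoWord (s : PiTerm Λ) : Saturated s.rhoWord.label := by
  induction s with
  | letter a =>
    have : Subsingleton (PiTerm.letter a : PiTerm Λ).rhoWord.Pos := inferInstanceAs (Subsingleton Unit)
    have : Nonempty (PiTerm.letter a : PiTerm Λ).rhoWord.Pos := inferInstanceAs (Nonempty Unit)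
    exact Saturated.of_subsingleton _
  | mul s t hs ht => exact hs.sum ht
  | pi s hs => exact saturated_rho.prod hs

end Saturation
/-! ### First-order formulae and syntactic monoids -/

section Formulae

universe u v
variable {Λ : Type u} {V : Type v}

/-- The quantifier depth of a formula. -/
def Formula.depth : Formula Λ V → ℕ
  | .atom _ => 0
  | .neg φ => φ.depth
  | .or φ ψ | .and φ ψ => max φ.depth ψ.depth
  | .ex _ φ | .all _ φ => φ.depth + 1

theorem Valuation.extend_self {p : Word Λ} (α : Valuation V p) (x : V) (q : p.Pos) :
    α.extend x q x = some q := if_pos rfl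

theorem Valuation.extend_of_ne {p : Word Λ} (α : Valuation V p) {x y : V} (q : p.Pos)
    (h : y ≠ x) : α.extend x q y = α y := if_neg h

/-- The variables in `X` have values under `α` and `β` that form a pair in `S`. -/
def ValuePairs {p q : Word Λ} (α : Valuation V p) (β : Valuation V q) (S : Set (p.Pos × q.Pos))
    (X : Set V) : Prop :=
  ∀ x ∈ X, ∃ i j, α x = some i ∧ β x = some j ∧ (i, j) ∈ S

theorem ValuePairs.extend {p q : Word Λ} {α : Valuation V p} {β : Valuation V q}
    {S : Set (p.Pos × q.Pos)} {X : Set V} {x : V} (h : ValuePairs α β S (X \ {x})) (i : p.Pos)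
    (j : q.Pos) : ValuePairs (α.extend x i) (β.extend x j) (insert (i, j) S) X := by
  intro y hy
  by_cases hyx : y = x
  · subst hyx
    exact ⟨i, j, Valuation.extend_self _ _ _, Valuation.extend_self _ _ _, Set.mem_insert _ _⟩
  · obtain ⟨i', j', h1, h2, h3⟩ := h y ⟨hy, hyx⟩
    exact ⟨i', j', by rwa [Valuation.extend_of_ne _ _ hyx], by rwa [Valuation.extend_of_ne _ _ hyx],
      Set.mem_insert_of_mem _ h3⟩

theorem BF.sat_atom_iff {p q : Word Λ} {n : ℕ} {S : Set (p.Pos × q.Pos)}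
    (hS : BF p.label q.label n S) {a : Atom Λ V} (ha : ¬ a.IsSucMinMaxEmpty)
    {α : Valuation V p} {β : Valuation V q} (h : ValuePairs α β S a.vars) :
    a.Sat p α ↔ a.Sat q β := by
  cases a with
  | top => exact Iff.rfl
  | bot => exact Iff.rfl
  | empty => exact (ha trivial).elim
  | suc x y => exact (ha trivial).elim
  | min x => exact (ha trivial).elim
  | max x => exact (ha trivial).elim
  | eq x y =>
    obtain ⟨i, j, h1, h2, h3⟩ := h x (.inl rfl)
    obtain ⟨i', j', h1', h2', h3'⟩ := h y (.inr rfl)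
    simpa [Atom.Sat, *] using hS.eq_iff h3' h3
  | lt x y =>
    obtain ⟨i, j, h1, h2, h3⟩ := h x (.inl rfl)
    obtain ⟨i', j', h1', h2', h3'⟩ := h y (.inr rfl)
    simpa [Atom.Sat, *] using hS.lt_iff h3 h3'
  | le x y =>
    obtain ⟨i, j, h1, h2, h3⟩ := h x (.inl rfl)
    obtain ⟨i', j', h1', h2', h3'⟩ := h y (.inr rfl)
    simpa [Atom.Sat, *] using not_congr (hS.lt_iff h3' h3)
  | label x a =>
    obtain ⟨i, j, h1, h2, h3⟩ := h x rfl
    simp [Atom.Sat, *, hS.label_eq h3]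

theorem BF.sat_iff {p q : Word Λ} {φ : Formula Λ V} {n : ℕ} {S : Set (p.Pos × q.Pos)}
    (hS : BF p.label q.label n S) (hφ : φ.AvoidsSucMinMaxEmpty) (hn : φ.depth ≤ n)
    {α : Valuation V p} {β : Valuation V q} (h : ValuePairs α β S φ.freeVars) :
    φ.Sat p α ↔ φ.Sat q β := by
  induction φ generalizing n S α β with
  | atom a => exact hS.sat_atom_iff hφ h
  | neg φ ih => exact not_congr (ih hS hφ hn h)
  | or φ ψ ih1 ih2 =>
    exact or_congr (ih1 hS hφ.1 (le_trans (le_max_left _ _) hn) fun x hx => h x (.inl hx))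
      (ih2 hS hφ.2 (le_trans (le_max_right _ _) hn) fun x hx => h x (.inr hx))
  | and φ ψ ih1 ih2 =>
    exact and_congr (ih1 hS hφ.1 (le_trans (le_max_left _ _) hn) fun x hx => h x (.inl hx))
      (ih2 hS hφ.2 (le_trans (le_max_right _ _) hn) fun x hx => h x (.inr hx))
  | ex x φ ih =>
    obtain ⟨n, rfl⟩ : ∃ m, n = m + 1 := ⟨n - 1, by simp only [Formula.depth] at hn; omega⟩
    have hn' : φ.depth ≤ n := by simpa [Formula.depth] using hn
    constructor
    · rintro ⟨i, hi⟩
      obtain ⟨j, hj⟩ := hS.1 i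
      exact ⟨j, (ih hj hφ hn' (h.extend i j)).1 hi⟩
    · rintro ⟨j, hj⟩
      obtain ⟨i, hi⟩ := hS.2 j
      exact ⟨i, (ih hi hφ hn' (h.extend i j)).2 hj⟩
  | all x φ ih =>
    obtain ⟨n, rfl⟩ : ∃ m, n = m + 1 := ⟨n - 1, by simp only [Formula.depth] at hn; omega⟩
    have hn' : φ.depth ≤ n := by simpa [Formula.depth] using hn
    constructor
    · intro hp j
      obtain ⟨i, hi⟩ := hS.2 j
      exact (ih hi hφ hn' (h.extend i j)).1 (hp i)
    · intro hp i
      obtain ⟨j, hj⟩ := hS.1 i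
      exact (ih hj hφ hn' (h.extend i j)).2 (hp j)

theorem BF.models_iff {p q : Word Λ} {φ : Formula Λ V} {n : ℕ}
    (hS : BF p.label q.label n ∅) (hφ : φ.AvoidsSucMinMaxEmpty) (hs : φ.IsSentence)
    (hn : φ.depth ≤ n) : Models p φ ↔ Models q φ :=
  hS.sat_iff hφ hn fun x hx => by rw [hs] at hx; exact hx.elim

/-- There are finitely many types of `k`-tuples in words over a finite alphabet, with respect to
the game with `n` rounds. -/
theorem exists_finite_types (A : Finset Λ) (n k : ℕ) : ∃ (τ : Type u) (_ : Finite τ)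
    (tp : (Σ p : Word Λ, (Fin k → p.Pos)) → τ), ∀ (p q : Word Λ) (a : Fin k → p.Pos)
      (b : Fin k → q.Pos), (∀ i, p.label i ∈ A) → (∀ i, q.label i ∈ A) →
      tp ⟨p, a⟩ = tp ⟨q, b⟩ → BF p.label q.label n (Set.range fun i => (a i, b i)) := by
  classical
  induction n generalizing k with
  | zero =>
    -- The type without rounds records letters and strict order; `none` stands for a letter outside
    -- of `A`.
    refine ⟨(Fin k → Option A) × (Fin k → Fin k → Prop), inferInstance, fun x =>
      ⟨fun i => if h : x.1.label (x.2 i) ∈ A then some ⟨_, h⟩ else none,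
        fun i j => x.2 i < x.2 j⟩, ?_⟩
    rintro p q a b hp hq heq _ ⟨i, rfl⟩
    rw [Prod.mk.injEq] at heq
    refine ⟨?_, ?_⟩
    · simpa [hp, hq] using congrFun heq.1 i
    · rintro _ ⟨j, rfl⟩
      exact iff_of_eq (congrFun (congrFun heq.2 i) j)
  | succ n ih =>
    obtain ⟨τ, _, tp, htp⟩ := ih (k + 1)
    -- The type for `n + 1` rounds is the set of types for `n` rounds of all extensions by one
    -- position.
    refine ⟨Set τ, inferInstance, fun x => Set.range fun i : x.1.Pos =>
      tp ⟨x.1, Fin.cons (α := fun _ => x.1.Pos) i x.2⟩, ?_⟩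
    intro p q a b hp hq heq
    have key : ∀ (i : p.Pos) (j : q.Pos),
        tp ⟨p, Fin.cons (α := fun _ => p.Pos) i a⟩ = tp ⟨q, Fin.cons (α := fun _ => q.Pos) j b⟩ →
        BF p.label q.label n (insert (i, j) (Set.range fun i => (a i, b i))) := by
      intro i j h
      refine (htp _ _ _ _ hp hq h).mono ?_
      rintro _ (rfl | ⟨l, rfl⟩)
      · exact ⟨0, rfl⟩
      · exact ⟨l.succ, rfl⟩
    refine ⟨fun i => ?_, fun j => ?_⟩
    · obtain ⟨j, hj⟩ := (Set.ext_iff.1 heq _).1 ⟨i, rfl⟩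
      exact ⟨j, key i j hj.symm⟩
    · obtain ⟨i, hi⟩ := (Set.ext_iff.1 heq _).2 ⟨j, rfl⟩
      exact ⟨i, key i j hi⟩

/-- A finite word over `A ⊆ Λ` as a labelled order. -/
def toWord {A : Finset Λ} (w : FreeMonoid A) : Word Λ := Word.ofList (w.toList.map Subtype.val)

theorem toWord_label_mem {A : Finset Λ} (w : FreeMonoid A) (i : (toWord w).Pos) :
    (toWord w).label i ∈ A := by
  have h : (toWord w).label i ∈ w.toList.map Subtype.val := List.get_mem _ _
  obtain ⟨a, -, ha⟩ := List.mem_map.1 h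
  rw [← ha]
  exact a.2

/-! ### Products and powers of finite words -/

theorem bf_get_append (l l' : List Λ) (n : ℕ) :
    BF (fun i : Fin l.length ⊕ₗ Fin l'.length => Sum.elim l.get l'.get (ofLex i)) (l ++ l').get n
      ∅ := by
  let e : Fin l.length ⊕ₗ Fin l'.length → Fin (l ++ l').length := fun i =>
    Fin.cast List.length_append.symm (Sum.elim (Fin.castAdd l'.length) (Fin.natAdd l.length) (ofLex i))
  refine BF.of_graph (e := e) ?_ ?_ ?_ (fun x hx => hx.elim)
  · rintro (i | i) (j | j) h
    · have h' : i < j := Sum.Lex.inl_lt_inl_iff.1 h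
      exact h'
    · change (i : ℕ) < l.length + j
      omega
    · exact (Sum.Lex.not_inr_lt_inl h).elim
    · have h' : i < j := Sum.Lex.inr_lt_inr_iff.1 h
      change l.length + (i : ℕ) < l.length + j
      omega
  · intro j
    have hj := j.2.trans_eq List.length_append
    by_cases h : (j : ℕ) < l.length
    · exact ⟨toLex (Sum.inl ⟨j, h⟩), rfl⟩
    · refine ⟨toLex (Sum.inr ⟨j - l.length, by omega⟩), Fin.ext ?_⟩
      change l.length + ((j : ℕ) - l.length) = j
      omega
  · rintro (i | i)
    · exact (List.getElem_append_left i.2).symm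
    · refine Eq.symm ((List.getElem_append_right (Nat.le_add_right l.length i)).trans ?_)
      change l'[l.length + (i : ℕ) - l.length]'_ = l'[(i : ℕ)]'_
      simp

theorem bf_ofList_append (l l' : List Λ) (n : ℕ) :
    BF ((Word.ofList l).concat (Word.ofList l')).label (Word.ofList (l ++ l')).label n ∅ :=
  bf_get_append l l' n

theorem bf_toWord_mul {A : Finset Λ} (w w' : FreeMonoid A) (n : ℕ) :
    BF ((toWord w).concat (toWord w')).label (toWord (w * w')).label n ∅ := by
  have := bf_ofList_append (w.toList.map Subtype.val) (w'.toList.map Subtype.val) n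
  rwa [← List.map_append, ← FreeMonoid.toList_mul] at this

theorem BF.concat {p p' q q' : Word Λ} {n : ℕ} (h : BF p.label p'.label n ∅)
    (h' : BF q.label q'.label n ∅) : BF (p.concat q).label (p'.concat q').label n ∅ :=
  h.sum_empty h'

theorem BF.power {p p' : Word Λ} {T T' : Type} [LinearOrder T] [LinearOrder T'] {n : ℕ}
    (hT : BF (fun _ : T => ()) (fun _ : T' => ()) n ∅) (h : BF p.label p'.label n ∅) :
    BF (p.power T).label (p'.power T').label n ∅ :=
  hT.prod_empty h

theorem bf_toWord_pow {A : Finset Λ} (w : FreeMonoid A) (n m : ℕ) :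
    BF ((toWord w).power (Fin m)).label (toWord (w ^ m)).label n ∅ := by
  induction m with
  | zero =>
    exact BF.of_graph (e := fun i => (ofLex i).1.elim0) (fun i => (ofLex i).1.elim0)
      (fun i => i.elim0) (fun i => (ofLex i).1.elim0) (fun x hx => hx.elim)
  | succ m ih =>
    rw [pow_succ']
    refine BF.trans_empty (BF.symm_empty ?_)
      (((BF.refl fun x hx => hx.elim).concat ih).trans_empty (bf_toWord_mul _ _ n))
    let e : ((toWord w).concat ((toWord w).power (Fin m))).Pos →
        ((toWord w).power (Fin (m + 1))).Pos := fun i =>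
      Sum.elim (fun i => toLex (0, i)) (fun j => toLex ((ofLex j).1.succ, (ofLex j).2)) (ofLex i)
    refine BF.of_graph (e := e) ?_ ?_ ?_ (fun x hx => hx.elim)
    · rintro (i | i) (j | j) h
      · exact Prod.Lex.toLex_lt_toLex.2 (.inr ⟨rfl, Sum.Lex.inl_lt_inl_iff.1 h⟩)
      · exact Prod.Lex.toLex_lt_toLex.2 (.inl (Fin.succ_pos _))
      · exact (Sum.Lex.not_inr_lt_inl h).elim
      · rcases Prod.Lex.lt_iff.1 (Sum.Lex.inr_lt_inr_iff.1 h) with h | ⟨h, h'⟩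
        · exact Prod.Lex.toLex_lt_toLex.2 (.inl (Fin.succ_lt_succ_iff.2 h))
        · exact Prod.Lex.toLex_lt_toLex.2 (.inr ⟨congrArg Fin.succ h, h'⟩)
    · rintro ⟨t, i⟩
      refine Fin.cases ?_ (fun t => ?_) t
      · exact ⟨toLex (Sum.inl i), rfl⟩
      · exact ⟨toLex (Sum.inr (toLex (t, i))), rfl⟩
    · rintro (i | i) <;> rfl

/-- The natural map to the syntactic monoid identifies words of the same type. -/
theorem syntacticCon_of_bf {A : Finset Λ} {φ : Formula Λ V} (hφ : φ.AvoidsSucMinMaxEmpty)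
    (hs : φ.IsSentence) {w w' : FreeMonoid A}
    (h : BF (toWord w).label (toWord w').label φ.depth ∅) : syntacticCon (langOf A φ) w w' := by
  intro x y
  have hr : ∀ p : Word Λ, BF p.label p.label φ.depth ∅ := fun p => BF.refl fun x hx => hx.elim
  refine BF.models_iff ?_ hφ hs le_rfl
  refine (bf_toWord_mul _ _ _).symm_empty.trans_empty
    (BF.trans_empty (BF.concat ?_ (hr _)) (bf_toWord_mul _ _ _))
  exact (bf_toWord_mul _ _ _).symm_empty.trans_empty
    (BF.trans_empty (BF.concat (hr _) h) (bf_toWord_mul _ _ _))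

theorem finite_syntacticMonoid {A : Finset Λ} {φ : Formula Λ V} (hφ : φ.AvoidsSucMinMaxEmpty)
    (hs : φ.IsSentence) : Finite (SyntacticMonoid (langOf A φ)) := by
  obtain ⟨τ, _, tp, htp⟩ := exists_finite_types A φ.depth 0
  refine Finite.of_injective (β := τ)
    (fun x => tp ⟨toWord (Quotient.out x : FreeMonoid A), Fin.elim0⟩) fun x y hxy => ?_
  rw [← Quotient.out_eq x, ← Quotient.out_eq y]
  exact Quotient.sound (syntacticCon_of_bf hφ hs
    ((htp _ _ _ _ (toWord_label_mem _) (toWord_label_mem _) hxy).mono (Set.empty_subset _)))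

theorem idemPow_eq {M : Type*} [Monoid M] {x : M} {m : ℕ} (hm : 1 ≤ m)
    (h : IsIdempotentElem (x ^ m)) : idemPow x = x ^ m := by
  have hex : ∃ e : M, IsIdempotentElem e ∧ ∃ k : ℕ, 1 ≤ k ∧ x ^ k = e := ⟨_, h, m, hm, rfl⟩
  rw [idemPow, dif_pos hex]
  obtain ⟨he, k, hk, hke⟩ := hex.choose_spec
  have key : ∀ (e : M), IsIdempotentElem e → ∀ k, 1 ≤ k → e ^ k = e := fun e he k hk => by
    obtain ⟨k, rfl⟩ : ∃ l, k = l + 1 := ⟨k - 1, by omega⟩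
    exact he.pow_succ_eq k
  -- Two idempotent powers `x ^ k` and `x ^ m` both equal `x ^ (k * m)`.
  rw [← key _ he m hm, ← key _ h k hk, ← hke, ← pow_mul, ← pow_mul, mul_comm]

/-- Words with the `π`-powers replaced by `m`-th powers. -/
def PiTerm.finWord {A : Finset Λ} (m : ℕ) (w : Λ → FreeMonoid A) (s : PiTerm Λ) : FreeMonoid A :=
  s.eval (· * ·) (· ^ m) w

/-- The orders with `m + 1` and `2 * m + 2` points are both equivalent to `ϱ` up to the depth of
`φ`. So `v ^ (m + 1)` is idempotent modulo the syntactic congruence, and one exponent serves all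
`π`-powers in the term. -/
theorem eval_syntacticMonoid {A : Finset Λ} {φ : Formula Λ V} (hφ : φ.AvoidsSucMinMaxEmpty)
    (hs : φ.IsSentence) {m : ℕ} (hm : 2 ^ φ.depth ≤ m) (w : Λ → FreeMonoid A) (s : PiTerm Λ) :
    s.eval (· * ·) idemPow (fun a => ((w a : FreeMonoid A) : SyntacticMonoid (langOf A φ))) =
      ((s.finWord (m + 1) w : FreeMonoid A) : SyntacticMonoid (langOf A φ)) := by
  have coe_pow : ∀ (v : FreeMonoid A) (k : ℕ),
      ((v ^ k : FreeMonoid A) : SyntacticMonoid (langOf A φ)) = (v : SyntacticMonoid _) ^ k :=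
    fun v k => map_pow (syntacticCon (langOf A φ)).mk' v k
  have hpow : ∀ v : FreeMonoid A, idemPow (v : SyntacticMonoid (langOf A φ)) =
      ((v ^ (m + 1) : FreeMonoid A) : SyntacticMonoid (langOf A φ)) := by
    intro v
    rw [coe_pow]
    refine idemPow_eq (by omega) ?_
    unfold IsIdempotentElem
    rw [← pow_add, ← coe_pow, ← coe_pow]
    refine (Con.eq _).2 (syntacticCon_of_bf hφ hs ?_)
    have hr := BF.refl (f := (toWord v).label) (n := φ.depth) (S := ∅) fun x hx => hx.elim
    have hT := (bf_fin_rho φ.depth (m + 1 + m) (by omega)).trans_empty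
      (bf_fin_rho φ.depth m hm).symm_empty
    exact (bf_toWord_pow _ _ _).symm_empty.trans_empty ((hT.power hr).trans_empty
      (bf_toWord_pow _ _ _))
  induction s with
  | letter a => rfl
  | mul s t ihs iht =>
    change s.eval _ _ _ * t.eval _ _ _ = _
    rw [ihs, iht]
    rfl
  | pi s ih =>
    change idemPow (s.eval _ _ _) = _
    rw [ih, hpow]
    rfl

/-- The generalized word `⟦s⟧_ϱ`, with the letters interpreted by generalized words. -/
def PiTerm.substWord (W : Λ → Word Λ) (s : PiTerm Λ) : Word Λ :=
  s.eval Word.concat (fun p => p.power Rho) W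

/-- The letters of a π-term. -/
def PiTerm.letters : PiTerm Λ → List Λ
  | .letter a => [a]
  | .mul s t => s.letters ++ t.letters
  | .pi s => s.letters

theorem PiTerm.bf_finWord {A : Finset Λ} {n m : ℕ} (hm : 2 ^ n ≤ m) (w : Λ → FreeMonoid A)
    (W : Λ → Word Λ) (s : PiTerm Λ)
    (h : ∀ a ∈ s.letters, BF (toWord (w a)).label (W a).label n ∅) :
    BF (toWord (s.finWord (m + 1) w)).label (s.substWord W).label n ∅ := by
  induction s with
  | letter a => exact h a (by simp [letters])
  | mul s t ihs iht =>
    exact (bf_toWord_mul _ _ _).symm_empty.trans_empty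
      ((ihs fun a ha => h a (by simp [letters, ha])).concat
        (iht fun a ha => h a (by simp [letters, ha])))
  | pi s ih =>
    exact (bf_toWord_pow _ _ _).symm_empty.trans_empty
      ((bf_fin_rho n m hm).power (ih h))

end Formulae
/-! ### Fragments and winning strategies -/

section Strategies

universe u v
variable {Λ : Type u} {V : Type v}

/-- The composition of contexts. -/
def Context.comp : Context Λ V → Context Λ V → Context Λ V
  | .hole, ν => ν
  | .neg μ, ν => .neg (μ.comp ν)
  | .orLeft μ ψ, ν => .orLeft (μ.comp ν) ψ
  | .orRight ψ μ, ν => .orRight ψ (μ.comp ν)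
  | .andLeft μ ψ, ν => .andLeft (μ.comp ν) ψ
  | .andRight ψ μ, ν => .andRight ψ (μ.comp ν)
  | .ex x μ, ν => .ex x (μ.comp ν)
  | .all x μ, ν => .all x (μ.comp ν)

theorem Context.fill_comp (μ ν : Context Λ V) (φ : Formula Λ V) :
    (μ.comp ν).fill φ = μ.fill (ν.fill φ) := by
  induction μ <;> simp_all [comp, fill]

theorem Formula.AvoidsSucMinMaxEmpty.of_fill {μ : Context Λ V} {φ : Formula Λ V}
    (h : (μ.fill φ).AvoidsSucMinMaxEmpty) : φ.AvoidsSucMinMaxEmpty := by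
  induction μ with
  | hole => exact h
  | neg μ ih => exact ih h
  | orLeft μ ψ ih => exact ih h.1
  | orRight ψ μ ih => exact ih h.2
  | andLeft μ ψ ih => exact ih h.1
  | andRight ψ μ ih => exact ih h.2
  | ex x μ ih => exact ih h
  | all x μ ih => exact ih h

/-- The closure properties of order-stable fragments in which none of the predicates `suc`, `min`,
`max`, `empty` occurs; the empty set is not excluded. -/
structure Admissible (F : Set (Formula Λ V)) : Prop where
  top : ∀ (μ : Context Λ V) (φ : Formula Λ V), μ.fill φ ∈ F → μ.fill (.atom .top) ∈ F
  bot : ∀ (μ : Context Λ V) (φ : Formula Λ V), μ.fill φ ∈ F → μ.fill (.atom .bot) ∈ F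
  label : ∀ (μ : Context Λ V) (φ : Formula Λ V) (x : V) (a : Λ),
    μ.fill φ ∈ F → μ.fill (.atom (.label x a)) ∈ F
  or : ∀ (μ : Context Λ V) (φ ψ : Formula Λ V),
    μ.fill (.or φ ψ) ∈ F ↔ μ.fill φ ∈ F ∧ μ.fill ψ ∈ F
  and : ∀ (μ : Context Λ V) (φ ψ : Formula Λ V),
    μ.fill (.and φ ψ) ∈ F ↔ μ.fill φ ∈ F ∧ μ.fill ψ ∈ F
  neg_neg : ∀ (μ : Context Λ V) (φ : Formula Λ V),
    μ.fill (.neg (.neg φ)) ∈ F → μ.fill φ ∈ F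
  ex : ∀ (μ : Context Λ V) (x : V) (φ : Formula Λ V),
    μ.fill (.ex x φ) ∈ F → x ∉ φ.freeVars → μ.fill φ ∈ F
  all : ∀ (μ : Context Λ V) (x : V) (φ : Formula Λ V),
    μ.fill (.all x φ) ∈ F → x ∉ φ.freeVars → μ.fill φ ∈ F
  lt_iff_le : IsOrderStable F
  avoids : ∀ φ ∈ F, φ.AvoidsSucMinMaxEmpty

theorem IsFragment.admissible {F : Set (Formula Λ V)} (hF : IsFragment F) (hord : IsOrderStable F)
    (hpred : ∀ φ ∈ F, φ.AvoidsSucMinMaxEmpty) : Admissible F where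
  top := hF.top
  bot := hF.bot
  label := hF.label
  or := hF.or
  and := hF.and
  neg_neg := hF.neg_neg
  ex := hF.ex
  all := hF.all
  lt_iff_le := hord
  avoids := hpred

/-- All closure rules hold under arbitrary contexts, so a rule at `μ` for the preimage is the rule
at `ν.comp μ` for `F`. Reducts and `negPreimage` are special cases. -/
theorem Admissible.preimage {F : Set (Formula Λ V)} (hF : Admissible F) (ν : Context Λ V) :
    Admissible {φ | ν.fill φ ∈ F} where
  top μ φ h := by
    have := hF.top (ν.comp μ) φ
    rw [ν.fill_comp, ν.fill_comp] at this
    exact this h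
  bot μ φ h := by
    have := hF.bot (ν.comp μ) φ
    rw [ν.fill_comp, ν.fill_comp] at this
    exact this h
  label μ φ x a h := by
    have := hF.label (ν.comp μ) φ x a
    rw [ν.fill_comp, ν.fill_comp] at this
    exact this h
  or μ φ ψ := by
    have := hF.or (ν.comp μ) φ ψ
    rw [ν.fill_comp, ν.fill_comp, ν.fill_comp] at this
    exact this
  and μ φ ψ := by
    have := hF.and (ν.comp μ) φ ψ
    rw [ν.fill_comp, ν.fill_comp, ν.fill_comp] at this
    exact this
  neg_neg μ φ h := by
    have := hF.neg_neg (ν.comp μ) φ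
    rw [ν.fill_comp, ν.fill_comp] at this
    exact this h
  ex μ x φ h hx := by
    have := hF.ex (ν.comp μ) x φ
    rw [ν.fill_comp, ν.fill_comp] at this
    exact this h hx
  all μ x φ h hx := by
    have := hF.all (ν.comp μ) x φ
    rw [ν.fill_comp, ν.fill_comp] at this
    exact this h hx
  lt_iff_le μ x y := by
    have := hF.lt_iff_le (ν.comp μ) x y
    rw [ν.fill_comp, ν.fill_comp] at this
    exact this
  avoids φ h := (hF.avoids _ h).of_fill

/-- The formulae whose negation is in `F`. -/
def negPreimage (F : Set (Formula Λ V)) : Set (Formula Λ V) := {φ | .neg φ ∈ F}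

theorem Admissible.negPreimage {F : Set (Formula Λ V)} (hF : Admissible F) :
    Admissible (negPreimage F) :=
  hF.preimage (.neg .hole)

theorem Admissible.reduct {F : Set (Formula Λ V)} (hF : Admissible F) (Q : Quant) (x : V) :
    Admissible (reduct Q x F) := by
  cases Q
  · exact hF.preimage (.ex x .hole)
  · exact hF.preimage (.all x .hole)
  · exact hF.preimage (.neg (.ex x .hole))
  · exact hF.preimage (.neg (.all x .hole))

/-- Duplicator wins if she can preserve an invariant that excludes Spoiler's winning condition. -/
theorem duplicatorWins_of_invariant {F : Set (Formula Λ V)} {p q : Word Λ}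
    (W : Config Λ V → Prop) (h0 : W (Config.start F p q)) (hw : ∀ S, W S → ¬ S.SpoilerWon)
    (hn : ∀ S, W S → ∀ c : S.Challenge, ∃ r, W (S.next c r)) : DuplicatorWins F p q := by
  classical
  let σ : Strategy (Config.start F p q) := fun S _ c =>
    if h : W S then some (hn S h c).choose else none
  have key : ∀ (S : Config Λ V) (H : History (Config.start F p q) S), σ.Follows H → W S := by
    intro S H
    induction H with
    | init => exact fun _ => h0
    | @round S H c r ih =>
      rintro ⟨h1, h2⟩
      have hS := ih h1
      have h3 : σ S H c = some (hn S hS c).choose := dif_pos hS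
      rw [← Option.some.inj (h3.symm.trans h2)]
      exact (hn S hS c).choose_spec
  refine ⟨σ, fun S H hH => ⟨hw S (key S H hH), fun c => ⟨_, dif_pos (key S H hH)⟩⟩⟩

/-- A strategy may depend on the history, but it suffices to know that some history following it
leads to the configuration. -/
theorem DuplicatorWins.exists_invariant {F : Set (Formula Λ V)} {p q : Word Λ}
    (h : DuplicatorWins F p q) : ∃ W : Config Λ V → Prop, W (Config.start F p q) ∧
      (∀ S, W S → ¬ S.SpoilerWon) ∧ ∀ S, W S → ∀ c : S.Challenge, ∃ r, W (S.next c r) := by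
  obtain ⟨σ, hσ⟩ := h
  refine ⟨fun S => ∃ H : History (Config.start F p q) S, σ.Follows H, ⟨.init, trivial⟩, ?_, ?_⟩
  · rintro S ⟨H, hH⟩
    exact (hσ S H hH).1
  · rintro S ⟨H, hH⟩ c
    obtain ⟨r, hr⟩ := (hσ S H hH).2 c
    exact ⟨r, .round H c r, hH, hr⟩

/-- A directed family of formulae, each of which is satisfiable in a saturated word, is
simultaneously satisfiable. -/
theorem Saturated.realize {q : Word Λ} (hq : Saturated q.label) {β : Valuation V q}
    (hβ : β.dom.Finite) {x : V} {Φ : Set (Formula Λ V)} (hne : Φ.Nonempty)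
    (hav : ∀ φ ∈ Φ, φ.AvoidsSucMinMaxEmpty) (hfree : ∀ φ ∈ Φ, φ.freeVars \ {x} ⊆ β.dom)
    (hdir : ∀ φ ∈ Φ, ∀ ψ ∈ Φ, ∃ χ ∈ Φ, ∀ j, χ.Sat q (β.extend x j) →
      φ.Sat q (β.extend x j) ∧ ψ.Sat q (β.extend x j))
    (hsat : ∀ φ ∈ Φ, ∃ j, φ.Sat q (β.extend x j)) : ∃ j, ∀ φ ∈ Φ, φ.Sat q (β.extend x j) := by
  let D : Formula Λ V → Set q.Pos := fun φ => {j | φ.Sat q (β.extend x j)}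
  obtain ⟨φ₀, hφ₀⟩ := hne
  have hbot : (⨅ φ ∈ Φ, Filter.principal (D φ)).NeBot := by
    have : Nonempty Φ := ⟨⟨φ₀, hφ₀⟩⟩
    rw [iInf_subtype']
    refine Filter.iInf_neBot_of_directed' ?_ fun φ => Filter.principal_neBot_iff.2 (hsat φ φ.2)
    intro φ ψ
    obtain ⟨χ, hχ, h⟩ := hdir φ φ.2 ψ ψ.2
    exact ⟨⟨χ, hχ⟩, Filter.principal_mono.2 fun j hj => (h j hj).1,
      Filter.principal_mono.2 fun j hj => (h j hj).2⟩
  let U := Ultrafilter.of (⨅ φ ∈ Φ, Filter.principal (D φ))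
  have hA : {j | ∃ y ∈ β.dom, β y = some j}.Finite := by
    refine ((hβ.image β).preimage (f := some) (Option.some_injective _).injOn).subset ?_
    rintro j ⟨y, hy, hj⟩
    exact ⟨y, hy, hj⟩
  -- By directedness `U` contains the solution set of every formula of `Φ`. The point `r` agrees
  -- with `U`-almost all points up to the depth of each formula, over the values of `β`.
  obtain ⟨r, hr⟩ := hq _ hA U
  refine ⟨r, fun φ hφ => ?_⟩
  have hU : D φ ∈ U := Ultrafilter.of_le _ (Filter.mem_iInf_of_mem φ
    (Filter.mem_iInf_of_mem hφ (Filter.mem_principal_self _)))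
  obtain ⟨r', h1, h2⟩ := U.nonempty_of_mem (Filter.inter_mem (hr φ.depth) hU)
  have hv : ValuePairs β β (diag {j | ∃ y ∈ β.dom, β y = some j}) (φ.freeVars \ {x}) := by
    intro y hy
    have hy' := hfree φ hφ hy
    obtain ⟨j, hj⟩ := Option.ne_none_iff_exists'.1 hy'
    exact ⟨j, j, hj, hj, ⟨y, hy', hj⟩, rfl⟩
  exact (BF.sat_iff h1 (hav φ hφ) le_rfl (hv.extend r r')).2 h2

/-! ### Preservation of truth as an invariant of the game -/

theorem Valuation.dom_extend {p : Word Λ} (α : Valuation V p) (x : V) (i : p.Pos) :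
    (α.extend x i).dom = insert x α.dom := by
  ext y
  by_cases h : y = x
  · subst h
    simp [dom, extend_self]
  · simp [dom, extend_of_ne _ _ h, h]

/-- The words are saturated, and every formula of the current set is preserved from the left to the
right word. -/
structure Config.Preserving (S : Config Λ V) : Prop where
  admissible : Admissible S.frag
  saturated_left : Saturated S.left.label
  saturated_right : Saturated S.right.label
  dom_eq : S.leftVal.dom = S.rightVal.dom
  finite : S.leftVal.dom.Finite
  sat : ∀ φ ∈ S.frag, φ.freeVars ⊆ S.leftVal.dom → φ.Sat S.left S.leftVal →
    φ.Sat S.right S.rightVal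

section

variable {G : Set (Formula Λ V)} {p q : Word Λ} {α : Valuation V p} {β : Valuation V q}

theorem Config.Preserving.negPreimage (h : (Config.mk G p α q β).Preserving) :
    (Config.mk (negPreimage G) q β p α).Preserving where
  admissible := h.admissible.negPreimage
  saturated_left := h.saturated_right
  saturated_right := h.saturated_left
  dom_eq := h.dom_eq.symm
  finite := h.dom_eq ▸ h.finite
  sat φ hφ hfree hq := by
    by_contra hp
    exact h.sat (.neg φ) hφ (hfree.trans h.dom_eq.symm.subset) hp hq

/-- The reply has to satisfy every formula of the reduct that holds at `i`. These are closed under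
conjunction and include `⊤`, and each is satisfiable on the right because its existential
quantification is preserved. -/
theorem Config.Preserving.reduct_ex (h : (Config.mk G p α q β).Preserving) {x : V}
    (hne : (reduct .ex x G).Nonempty) (i : p.Pos) : ∃ j,
    (Config.mk (reduct .ex x G) p (α.extend x i) q (β.extend x j)).Preserving := by
  have hdom : α.dom = β.dom := h.dom_eq
  refine (h.saturated_right.realize (hdom ▸ h.finite) (x := x)
    (Φ := {φ | φ ∈ reduct .ex x G ∧ φ.freeVars \ {x} ⊆ α.dom ∧ φ.Sat p (α.extend x i)}) ?_
    (fun φ hφ => (h.admissible.reduct .ex x).avoids φ hφ.1) (fun φ hφ => hdom ▸ hφ.2.1) ?_ ?_).imp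
      fun j hj => ?_
  rotate_right
  · refine ⟨ h.admissible.reduct .ex x, h.saturated_left, h.saturated_right, ?_, ?_, ?_⟩
    · simp only [Valuation.dom_extend, hdom]
    · simpa only [Valuation.dom_extend] using h.finite.insert x
    · intro φ hφ hfree hs
      rw [Valuation.dom_extend] at hfree
      exact hj φ ⟨hφ, by simpa using hfree, hs⟩
  · obtain ⟨φ, hφ⟩ := hne
    exact ⟨.atom .top, h.admissible.top (.ex x .hole) φ hφ, by simp [Formula.freeVars, Atom.vars],
      trivial⟩
  · rintro φ ⟨h1, h2, h3⟩ ψ ⟨h1', h2', h3'⟩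
    exact ⟨.and φ ψ, ⟨(h.admissible.and (.ex x .hole) φ ψ).2 ⟨h1, h1'⟩,
      by rw [Formula.freeVars, Set.union_sdiff_distrib]; exact Set.union_subset h2 h2', h3, h3'⟩,
      fun j hj => hj⟩
  · rintro φ ⟨h1, h2, h3⟩
    exact h.sat (.ex x φ) h1 h2 ⟨i, h3⟩

/-- Dually, the reply has to falsify every formula of the reduct that fails at `j`. These are closed
under disjunction and include `⊥`; if one held everywhere on the left, its universal quantification
would be preserved, against its failure at `j`. -/
theorem Config.Preserving.reduct_all (h : (Config.mk G p α q β).Preserving) {x : V}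
    (hne : (reduct .all x G).Nonempty) (j : q.Pos) : ∃ i,
    (Config.mk (reduct .all x G) p (α.extend x i) q (β.extend x j)).Preserving := by
  have hdom : α.dom = β.dom := h.dom_eq
  refine (h.saturated_left.realize h.finite (x := x)
    (Φ := {ψ | ∃ φ, ψ = .neg φ ∧ φ ∈ reduct .all x G ∧ φ.freeVars \ {x} ⊆ α.dom ∧
      ¬ φ.Sat q (β.extend x j)}) ?_ ?_ ?_ ?_ ?_).imp fun i hi => ?_
  rotate_right
  · refine ⟨ h.admissible.reduct .all x, h.saturated_left, h.saturated_right, ?_, ?_, ?_⟩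
    · simp only [Valuation.dom_extend, hdom]
    · simpa only [Valuation.dom_extend] using h.finite.insert x
    · intro φ hφ hfree hs
      rw [Valuation.dom_extend] at hfree
      by_contra hq
      exact hi (.neg φ) ⟨φ, rfl, hφ, by simpa using hfree, hq⟩ hs
  · obtain ⟨φ, hφ⟩ := hne
    exact ⟨_, _, rfl, h.admissible.bot (.all x .hole) φ hφ, by simp [Context.fill, Formula.freeVars, Atom.vars],
      fun h => h⟩
  · rintro _ ⟨φ, rfl, hφ, -⟩
    exact (h.admissible.reduct .all x).avoids φ hφ
  · rintro _ ⟨φ, rfl, -, hφ, -⟩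
    exact hφ
  · rintro _ ⟨φ, rfl, h1, h2, h3⟩ _ ⟨ψ, rfl, h1', h2', h3'⟩
    exact ⟨.neg (.or φ ψ), ⟨_, rfl, (h.admissible.or (.all x .hole) φ ψ).2 ⟨h1, h1'⟩,
      by rw [Formula.freeVars, Set.union_sdiff_distrib]; exact Set.union_subset h2 h2',
      not_or.2 ⟨h3, h3'⟩⟩, fun j hj => not_or.1 hj⟩
  · rintro _ ⟨φ, rfl, h1, h2, h3⟩
    by_contra hcon
    exact h3 (h.sat (.all x φ) h1 h2 (fun i => by_contra fun hi => hcon ⟨i, hi⟩) j)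

end

theorem Config.Preserving.duplicatorWins {F : Set (Formula Λ V)} {p q : Word Λ}
    (h : (Config.start F p q).Preserving) : DuplicatorWins F p q := by
  refine duplicatorWins_of_invariant Config.Preserving h ?_ ?_
  · rintro S hS ⟨φ, hφ, -, hfree, h1, h2⟩
    exact h2 (hS.sat φ hφ hfree h1)
  · rintro ⟨G, p, α, q, β⟩ hS ⟨Q, x, hne, i⟩
    cases Q
    · exact hS.reduct_ex hne i
    · exact hS.reduct_all hne i
    -- A negated quantifier amounts to the plain one after interchanging the words and passing to
    -- `negPreimage`.
    · exact hS.negPreimage.reduct_ex (x := x) hne i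
    · exact hS.negPreimage.reduct_all (x := x) hne i

end Strategies
/-! ### Substitution into generalized words -/

section Substitution

universe u v
variable {Λ : Type u} {V : Type v}

/-- A set of configurations from which Duplicator can play forever; it is closed under reading
formulae as negations with the words interchanged. -/
structure IsSimulation (R : Config Λ V → Prop) : Prop where
  atom : ∀ {G p α q β}, R ⟨G, p, α, q, β⟩ → ∀ a : Atom Λ V, .atom a ∈ G → a.vars ⊆ α.dom →
    a.vars ⊆ β.dom → a.Sat p α → a.Sat q β
  neg : ∀ {G p α q β}, R ⟨G, p, α, q, β⟩ → R ⟨negPreimage G, q, β, p, α⟩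
  ex : ∀ {G p α q β}, R ⟨G, p, α, q, β⟩ → ∀ x, (reduct .ex x G).Nonempty → ∀ i, ∃ j,
    R ⟨reduct .ex x G, p, α.extend x i, q, β.extend x j⟩
  all : ∀ {G p α q β}, R ⟨G, p, α, q, β⟩ → ∀ x, (reduct .all x G).Nonempty → ∀ j, ∃ i,
    R ⟨reduct .all x G, p, α.extend x i, q, β.extend x j⟩

/-- In the game, words are interchanged only along with a quantifier, whereas a simulation must
handle bare negations. So a related configuration remembers whether a negation is pending: a
quantifier consumes it, and a second negation cancels it by the rule for double negations. -/
theorem DuplicatorWins.exists_simulation {F : Set (Formula Λ V)} (hF : Admissible F)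
    {p q : Word Λ} (h : DuplicatorWins F p q) :
    ∃ R : Config Λ V → Prop, IsSimulation R ∧ R (Config.start F p q) := by
  obtain ⟨W, h0, hw, hn⟩ := h.exists_invariant
  refine ⟨fun S => ∃ G, Admissible G ∧
    ((S.frag ⊆ G ∧ W ⟨G, S.left, S.leftVal, S.right, S.rightVal⟩) ∨
      (S.frag ⊆ negPreimage G ∧ W ⟨G, S.right, S.rightVal, S.left, S.leftVal⟩)),
    ⟨?_, ?_, ?_, ?_⟩, ⟨F, hF, .inl ⟨subset_rfl, h0⟩⟩⟩
  · rintro G p α q β ⟨G', hG, ⟨hsub, hW⟩ | ⟨hsub, hW⟩⟩ a ha hα hβ hs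
    · by_contra hcon
      exact hw _ hW ⟨_, hsub ha, ⟨a, .inl rfl⟩, hα, hs, hcon⟩
    · by_contra hcon
      exact hw _ hW ⟨_, hsub ha, ⟨a, .inr rfl⟩, hβ, hcon, fun h => h hs⟩
  · rintro G p α q β ⟨G', hG, ⟨hsub, hW⟩ | ⟨hsub, hW⟩⟩
    · exact ⟨G', hG, .inr ⟨fun φ hφ => hsub hφ, hW⟩⟩
    · exact ⟨G', hG, .inl ⟨fun φ hφ => hG.neg_neg .hole φ (hsub hφ), hW⟩⟩
  · rintro G p α q β ⟨G', hG, ⟨hsub, hW⟩ | ⟨hsub, hW⟩⟩ x ⟨ψ, hψ⟩ i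
    · obtain ⟨j, hj⟩ := hn _ hW ⟨.ex, x, ⟨ψ, hsub hψ⟩, i⟩
      exact ⟨j, _, hG.reduct .ex x, .inl ⟨fun φ hφ => hsub hφ, hj⟩⟩
    · obtain ⟨j, hj⟩ := hn _ hW ⟨.notEx, x, ⟨ψ, hsub hψ⟩, i⟩
      exact ⟨j, _, hG.reduct .notEx x, .inl ⟨fun φ hφ => hsub hφ, hj⟩⟩
  · rintro G p α q β ⟨G', hG, ⟨hsub, hW⟩ | ⟨hsub, hW⟩⟩ x ⟨ψ, hψ⟩ i
    · obtain ⟨j, hj⟩ := hn _ hW ⟨.all, x, ⟨ψ, hsub hψ⟩, i⟩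
      exact ⟨j, _, hG.reduct .all x, .inl ⟨fun φ hφ => hsub hφ, hj⟩⟩
    · obtain ⟨j, hj⟩ := hn _ hW ⟨.notAll, x, ⟨ψ, hsub hψ⟩, i⟩
      exact ⟨j, _, hG.reduct .notAll x, .inl ⟨fun φ hφ => hsub hφ, hj⟩⟩

/-- The word `P` arises from the word `p` by substituting each letter `a` by the finite word
`w a`. -/
structure Fibration (w : Λ → List Λ) (P p : Word Λ) where
  addr : P.Pos → p.Pos
  off : P.Pos → ℕ
  lt_iff : ∀ a b, a < b ↔ addr a < addr b ∨ addr a = addr b ∧ off a < off b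
  label : ∀ a, (w (p.label (addr a)))[off a]? = some (P.label a)
  surj : ∀ i j, j < (w (p.label i)).length → ∃ a, addr a = i ∧ off a = j

theorem Fibration.eq_of {w : Λ → List Λ} {P p : Word Λ} (f : Fibration w P p) {a b : P.Pos}
    (h : f.addr a = f.addr b) (h' : f.off a = f.off b) : a = b := by
  rcases lt_trichotomy a b with hlt | heq | hlt
  · exact ((f.lt_iff _ _).1 hlt).elim (fun hl => (hl.ne h).elim) fun hl => (hl.2.ne h').elim
  · exact heq
  · exact ((f.lt_iff _ _).1 hlt).elim (fun hl => (hl.ne h.symm).elim)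
      fun hl => (hl.2.ne h'.symm).elim

theorem Fibration.exists_of_label_eq {w : Λ → List Λ} {P p Q q : Word Λ} (f : Fibration w P p)
    (g : Fibration w Q q) (a : P.Pos) {i : q.Pos} (h : p.label (f.addr a) = q.label i) :
    ∃ b, g.addr b = i ∧ g.off b = f.off a ∧ Q.label b = P.label a := by
  have h1 := f.label a
  obtain ⟨hlt, -⟩ := List.getElem?_eq_some_iff.1 h1
  rw [h] at hlt h1
  obtain ⟨b, hb, hb'⟩ := g.surj i _ hlt
  refine ⟨b, hb, hb', ?_⟩
  have h2 := g.label b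
  rw [hb, hb', h1] at h2
  exact (Option.some.inj h2).symm

theorem nonempty_fibration (w : Λ → List Λ) (s : PiTerm Λ) :
    Nonempty (Fibration w (s.substWord fun a => Word.ofList (w a)) s.rhoWord) := by
  induction s with
  | letter a =>
    exact ⟨{
      addr := fun _ => ()
      off := fun i : Fin (w a).length => (i : ℕ)
      lt_iff := fun i j => ⟨fun h => .inr ⟨rfl, h⟩, fun h => h.elim
        (fun h => (lt_irrefl () h).elim) fun h => h.2⟩
      label := fun i : Fin (w a).length => List.getElem?_eq_getElem i.2
      surj := fun i j h => ⟨⟨j, h⟩, rfl, rfl⟩ }⟩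
  | mul s t hs ht =>
    obtain ⟨f⟩ := hs
    obtain ⟨g⟩ := ht
    refine ⟨{
      addr := fun i => Sum.elim (fun i => toLex (Sum.inl (f.addr i)))
        (fun i => toLex (Sum.inr (g.addr i))) (ofLex i)
      off := fun i => Sum.elim f.off g.off (ofLex i)
      lt_iff := ?_
      label := ?_
      surj := ?_ }⟩
    · rintro (i | i) (j | j)
      · refine Sum.Lex.inl_lt_inl_iff.trans ((f.lt_iff i j).trans ?_)
        exact or_congr Sum.Lex.inl_lt_inl_iff.symm
          (and_congr_left' (toLex.injective.comp Sum.inl_injective).eq_iff.symm)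
      · exact iff_of_true (Sum.Lex.inl_lt_inr _ _) (.inl (Sum.Lex.inl_lt_inr _ _))
      · refine iff_of_false Sum.Lex.not_inr_lt_inl ?_
        rintro (h | ⟨h, -⟩)
        · exact Sum.Lex.not_inr_lt_inl h
        · exact Sum.inr_ne_inl (toLex.injective h)
      · refine Sum.Lex.inr_lt_inr_iff.trans ((g.lt_iff i j).trans ?_)
        exact or_congr Sum.Lex.inr_lt_inr_iff.symm
          (and_congr_left' (toLex.injective.comp Sum.inr_injective).eq_iff.symm)
    · rintro (i | i)
      · exact f.label i
      · exact g.label i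
    · rintro (i | i) j h
      · obtain ⟨a, rfl, rfl⟩ := f.surj i j h
        exact ⟨toLex (Sum.inl a), rfl, rfl⟩
      · obtain ⟨a, rfl, rfl⟩ := g.surj i j h
        exact ⟨toLex (Sum.inr a), rfl, rfl⟩
  | pi s hs =>
    obtain ⟨f⟩ := hs
    refine ⟨{
      addr := fun i => toLex ((ofLex i).1, f.addr (ofLex i).2)
      off := fun i => f.off (ofLex i).2
      lt_iff := ?_
      label := fun i => f.label _
      surj := ?_ }⟩
    · rintro ⟨t, i⟩ ⟨t', i'⟩
      have h1 := Prod.Lex.toLex_lt_toLex (x := (t, i)) (y := (t', i'))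
      have h2 := Prod.Lex.toLex_lt_toLex (x := (t, f.addr i)) (y := (t', f.addr i'))
      have h3 : (toLex (t, f.addr i) : Rho ×ₗ s.rhoWord.Pos) = toLex (t', f.addr i') ↔
        t = t' ∧ f.addr i = f.addr i' := by simp
      refine h1.trans (Iff.trans ?_ (or_congr h2.symm (and_congr_left' h3.symm)))
      have key : ∀ a b c d e g : Prop, (c ↔ d ∨ e ∧ g) →
          ((a ∨ b ∧ c) ↔ ((a ∨ b ∧ d) ∨ (b ∧ e) ∧ g)) := by
        intro a b c d e g h
        rw [h, and_or_left, or_assoc, and_assoc]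
      exact key _ _ _ _ _ _ (f.lt_iff i i')
    · rintro ⟨t, i⟩ j h
      obtain ⟨a, rfl, rfl⟩ := f.surj i j h
      exact ⟨toLex (t, a), rfl, rfl⟩

/-- The positions of `P` in the concatenation of `X`, `P` and `Y`. -/
def innerPos (X Y : Word Λ) {P : Word Λ} (a : P.Pos) : (X.concat (P.concat Y)).Pos :=
  toLex (Sum.inr (toLex (Sum.inl a)))

/-- The positions of `X` and `Y` in the concatenation of `X`, `P` and `Y`. -/
def outerPos {X Y : Word Λ} (P : Word Λ) (c : X.Pos ⊕ Y.Pos) : (X.concat (P.concat Y)).Pos :=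
  c.elim (fun i => toLex (Sum.inl i)) fun i => toLex (Sum.inr (toLex (Sum.inr i)))

section

variable {X Y P Q : Word Λ}

theorem outerPos_or_innerPos (i : (X.concat (P.concat Y)).Pos) :
    (∃ c, i = outerPos P c) ∨ ∃ a : P.Pos, i = innerPos X Y a := by
  rcases i with i | a | i
  · exact .inl ⟨.inl i, rfl⟩
  · exact .inr ⟨a, rfl⟩
  · exact .inl ⟨.inr i, rfl⟩

theorem label_outerPos (c : X.Pos ⊕ Y.Pos) : (X.concat (P.concat Y)).label (outerPos P c) =
    (X.concat (Q.concat Y)).label (outerPos Q c) := by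
  rcases c with c | c <;> rfl

theorem innerPos_lt_innerPos {a b : P.Pos} : innerPos X Y a < innerPos X Y b ↔ a < b :=
  Sum.Lex.inr_lt_inr_iff.trans Sum.Lex.inl_lt_inl_iff

theorem outerPos_lt_outerPos (c d : X.Pos ⊕ Y.Pos) :
    outerPos P c < outerPos P d ↔ outerPos Q c < outerPos Q d := by
  rcases c with c | c <;> rcases d with d | d
  · exact Sum.Lex.inl_lt_inl_iff.trans Sum.Lex.inl_lt_inl_iff.symm
  · exact iff_of_true (Sum.Lex.inl_lt_inr _ _) (Sum.Lex.inl_lt_inr _ _)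
  · exact iff_of_false Sum.Lex.not_inr_lt_inl Sum.Lex.not_inr_lt_inl
  · exact (Sum.Lex.inr_lt_inr_iff.trans Sum.Lex.inr_lt_inr_iff).trans
      (Sum.Lex.inr_lt_inr_iff.trans Sum.Lex.inr_lt_inr_iff).symm

theorem outerPos_lt_innerPos (c : X.Pos ⊕ Y.Pos) (a : P.Pos) :
    outerPos P c < innerPos X Y a ↔ c.isLeft := by
  rcases c with c | c
  · exact iff_of_true (Sum.Lex.inl_lt_inr _ _) rfl
  · exact iff_of_false (fun h => Sum.Lex.not_inr_lt_inl (Sum.Lex.inr_lt_inr_iff.1 h)) (by simp)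

theorem innerPos_lt_outerPos (c : X.Pos ⊕ Y.Pos) (a : P.Pos) :
    innerPos X Y a < outerPos P c ↔ c.isRight := by
  rcases c with c | c
  · exact iff_of_false Sum.Lex.not_inr_lt_inl (by simp)
  · exact iff_of_true (Sum.Lex.inr_lt_inr_iff.2 (Sum.Lex.inl_lt_inr _ _)) rfl

end

/-- A configuration on `X P Y` and `X Q Y` that is controlled by a configuration on `p` and `q`,
where `P` and `Q` arise from `p` and `q` by a substitution.  The variables in `D` are valued, those
in `Z` by positions outside of `P` and `Q`. -/
structure Controlled (R : Config Λ V → Prop) {w : Λ → List Λ} {X Y P Q p q : Word Λ}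
    (f : Fibration w P p) (g : Fibration w Q q) (G G' : Set (Formula Λ V))
    (α : Valuation V p) (β : Valuation V q) (α' : Valuation V (X.concat (P.concat Y)))
    (β' : Valuation V (X.concat (Q.concat Y))) (Z D : Set V) : Prop where
  admissible : Admissible G
  sim : R ⟨G', p, α, q, β⟩
  mem : ∀ φ ∈ G, Disjoint φ.freeVars Z → φ ∈ G'
  outer : ∀ z ∈ Z, ∃ c, α' z = some (outerPos P c) ∧ β' z = some (outerPos Q c)
  inner : ∀ z ∈ D, z ∉ Z → ∃ a b, α' z = some (innerPos X Y a) ∧ β' z = some (innerPos X Y b) ∧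
    α z = some (f.addr a) ∧ β z = some (g.addr b) ∧ f.off a = g.off b ∧ P.label a = Q.label b

namespace Controlled

variable {R : Config Λ V → Prop} {w : Λ → List Λ} {X Y P Q p q : Word Λ}
    {f : Fibration w P p} {g : Fibration w Q q} {G G' : Set (Formula Λ V)}
    {α : Valuation V p} {β : Valuation V q} {α' : Valuation V (X.concat (P.concat Y))}
    {β' : Valuation V (X.concat (Q.concat Y))} {Z D : Set V}

theorem neg (hR : IsSimulation R) (h : Controlled R f g G G' α β α' β' Z D) :
    Controlled R g f (negPreimage G) (negPreimage G') β α β' α' Z D where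
  admissible := h.admissible.negPreimage
  sim := hR.neg h.sim
  mem φ hφ hd := h.mem (.neg φ) hφ hd
  outer z hz := (h.outer z hz).imp fun _ hc => hc.symm
  inner z hz hz' := by
    obtain ⟨a, b, h1, h2, h3, h4, h5, h6⟩ := h.inner z hz hz'
    exact ⟨b, a, h2, h1, h4, h3, h5.symm, h6.symm⟩

/-- No round is played on `p` and `q`. An old value of `x` there does no harm, since `x` now belongs
to `Z` and only formulae without free variables in `Z` are tracked in `G'`. -/
theorem extend_outer (h : Controlled R f g G G' α β α' β' Z D) {G₁ : Set (Formula Λ V)} {x : V}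
    (hG₁ : Admissible G₁) (hsub : ∀ φ ∈ G₁, x ∉ φ.freeVars → φ ∈ G) (c : X.Pos ⊕ Y.Pos) :
    Controlled R f g G₁ G' α β (α'.extend x (outerPos P c)) (β'.extend x (outerPos Q c))
      (insert x Z) (insert x D) where
  admissible := hG₁
  sim := h.sim
  mem φ hφ hd := by
    rw [Set.disjoint_insert_right] at hd
    exact h.mem φ (hsub φ hφ hd.1) hd.2
  outer z hz := by
    by_cases hzx : z = x
    · subst hzx
      exact ⟨c, Valuation.extend_self _ _ _, Valuation.extend_self _ _ _⟩
    · rw [Valuation.extend_of_ne _ _ hzx, Valuation.extend_of_ne _ _ hzx]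
      exact h.outer z (hz.resolve_left hzx)
  inner z hz hz' := by
    have hzx : z ≠ x := fun h => hz' (.inl h)
    rw [Valuation.extend_of_ne _ _ hzx, Valuation.extend_of_ne _ _ hzx]
    exact h.inner z (hz.resolve_left hzx) fun h => hz' (.inr h)

theorem extend_inner (h : Controlled R f g G G' α β α' β' Z D) {G₁ G₁' : Set (Formula Λ V)}
    {x : V} (hG₁ : Admissible G₁)
    (hsub : ∀ φ ∈ G₁, Disjoint (φ.freeVars \ {x}) Z → φ ∈ G₁') {a : P.Pos} {b : Q.Pos}
    (hs : R ⟨G₁', p, α.extend x (f.addr a), q, β.extend x (g.addr b)⟩)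
    (hoff : f.off a = g.off b) (hlab : P.label a = Q.label b) :
    Controlled R f g G₁ G₁' (α.extend x (f.addr a)) (β.extend x (g.addr b))
      (α'.extend x (innerPos X Y a)) (β'.extend x (innerPos X Y b)) (Z \ {x}) (insert x D) where
  admissible := hG₁
  sim := hs
  mem φ hφ hd := hsub φ hφ (by
    rw [Set.disjoint_left] at *
    exact fun y hy hyZ => hd hy.1 ⟨hyZ, hy.2⟩)
  outer z hz := by
    rw [Valuation.extend_of_ne _ _ hz.2, Valuation.extend_of_ne _ _ hz.2]
    exact h.outer z hz.1
  inner z hz hz' := by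
    by_cases hzx : z = x
    · subst hzx
      exact ⟨a, b, Valuation.extend_self _ _ _, Valuation.extend_self _ _ _,
        Valuation.extend_self _ _ _, Valuation.extend_self _ _ _, hoff, hlab⟩
    · simp only [Valuation.extend_of_ne _ _ hzx]
      exact h.inner z (hz.resolve_left hzx) fun h => hz' ⟨h, hzx⟩

/-- Outside of `P`, the same position is the reply. Inside, the simulation answers at the address;
the label atom makes this round legal and forces equal letters, so that the offset can be copied. -/
theorem exists_ex (hR : IsSimulation R) (h : Controlled R f g G G' α β α' β' Z D) {x : V}
    {φ : Formula Λ V} (hφ : .ex x φ ∈ G) (i : (X.concat (P.concat Y)).Pos) :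
    ∃ j G₁' α₁ β₁ Z₁, Controlled R f g (reduct .ex x G) G₁' α₁ β₁ (α'.extend x i) (β'.extend x j)
      Z₁ (insert x D) := by
  have hadm := h.admissible.reduct .ex x
  obtain ⟨c, rfl⟩ | ⟨a, rfl⟩ := outerPos_or_innerPos i
  · exact ⟨_, _, _, _, _, h.extend_outer hadm
      (fun ψ hψ hx => h.admissible.ex .hole x ψ hψ hx) c⟩
  · have hlabel : Formula.atom (.label x (p.label (f.addr a))) ∈ reduct .ex x G' :=
      h.mem (.ex x (.atom (.label x _))) (h.admissible.label (.ex x .hole) φ x _ hφ)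
        (by simp [Formula.freeVars, Atom.vars])
    obtain ⟨r, hr⟩ := hR.ex h.sim x ⟨_, hlabel⟩ (f.addr a)
    obtain ⟨k, hk, hk'⟩ := hR.atom hr _ hlabel (by simp [Atom.vars, Valuation.dom_extend])
      (by simp [Atom.vars, Valuation.dom_extend]) ⟨_, Valuation.extend_self _ _ _, rfl⟩
    rw [Valuation.extend_self] at hk
    obtain rfl := Option.some.inj hk
    obtain ⟨b, rfl, hb, hb'⟩ := f.exists_of_label_eq g a hk'.symm
    exact ⟨_, _, _, _, _, h.extend_inner hadm (fun ψ hψ hd => h.mem (.ex x ψ) hψ hd) hr hb.symm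
      hb'.symm⟩

theorem exists_all (hR : IsSimulation R) (h : Controlled R f g G G' α β α' β' Z D) {x : V}
    {φ : Formula Λ V} (hφ : .all x φ ∈ G) (j : (X.concat (Q.concat Y)).Pos) :
    ∃ i G₁' α₁ β₁ Z₁, Controlled R f g (reduct .all x G) G₁' α₁ β₁ (α'.extend x i)
      (β'.extend x j) Z₁ (insert x D) := by
  have hadm := h.admissible.reduct .all x
  obtain ⟨c, rfl⟩ | ⟨b, rfl⟩ := outerPos_or_innerPos j
  · exact ⟨_, _, _, _, _, h.extend_outer hadm
      (fun ψ hψ hx => h.admissible.all .hole x ψ hψ hx) c⟩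
  · have hmem : ∀ c, Formula.atom (.label x c) ∈ reduct .all x G' := fun c =>
      h.mem (.all x (.atom (.label x _))) (h.admissible.label (.all x .hole) φ x _ hφ)
        (by simp [Formula.freeVars, Atom.vars])
    obtain ⟨r, hr⟩ := hR.all h.sim x ⟨_, hmem (q.label (g.addr b))⟩ (g.addr b)
    -- Atoms are preserved from left to right only, so the label atom is that of the reply `r` on
    -- the left.
    obtain ⟨k, hk, hk'⟩ := hR.atom hr _ (hmem (p.label r))
      (by simp [Atom.vars, Valuation.dom_extend]) (by simp [Atom.vars, Valuation.dom_extend])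
      ⟨_, Valuation.extend_self _ _ _, rfl⟩
    rw [Valuation.extend_self] at hk
    obtain rfl := Option.some.inj hk
    obtain ⟨a, rfl, ha, ha'⟩ := g.exists_of_label_eq f b hk'
    exact ⟨_, _, _, _, _, h.extend_inner hadm (fun ψ hψ hd => h.mem (.all x ψ) hψ hd) hr ha ha'⟩

/-- If one of the variables is valued outside of `P` and `Q`, then the positions are ordered in the
same way in both words. -/
theorem lt_iff_of_outer (h : Controlled R f g G G' α β α' β' Z D) {x y : V} (hx : x ∈ D)
    (hy : y ∈ D) (hxy : x ∈ Z ∨ y ∈ Z) : ∃ i i' j j', α' x = some i ∧ α' y = some i' ∧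
      β' x = some j ∧ β' y = some j' ∧ (i < i' ↔ j < j') ∧ (i' < i ↔ j' < j) := by
  by_cases hxZ : x ∈ Z <;> by_cases hyZ : y ∈ Z
  · obtain ⟨c, h1, h2⟩ := h.outer x hxZ
    obtain ⟨c', h1', h2'⟩ := h.outer y hyZ
    exact ⟨_, _, _, _, h1, h1', h2, h2', outerPos_lt_outerPos _ _, outerPos_lt_outerPos _ _⟩
  · obtain ⟨c, h1, h2⟩ := h.outer x hxZ
    obtain ⟨a, b, h1', h2', -⟩ := h.inner y hy hyZ
    exact ⟨_, _, _, _, h1, h1', h2, h2',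
      (outerPos_lt_innerPos _ _).trans (outerPos_lt_innerPos _ _).symm,
      (innerPos_lt_outerPos _ _).trans (innerPos_lt_outerPos _ _).symm⟩
  · obtain ⟨c, h1, h2⟩ := h.outer y hyZ
    obtain ⟨a, b, h1', h2', -⟩ := h.inner x hx hxZ
    exact ⟨_, _, _, _, h1', h1, h2', h2,
      (innerPos_lt_outerPos _ _).trans (innerPos_lt_outerPos _ _).symm,
      (outerPos_lt_innerPos _ _).trans (outerPos_lt_innerPos _ _).symm⟩
  · exact (hxy.elim hxZ hyZ).elim

theorem sat_atom (hR : IsSimulation R) (h : Controlled R f g G G' α β α' β' Z D) {a : Atom Λ V}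
    (ha : .atom a ∈ G) (hD : a.vars ⊆ D) (hs : a.Sat _ α') : a.Sat _ β' := by
  have hav := h.admissible.avoids _ ha
  have hbin : ∀ {x y}, ¬ (x ∈ Z ∨ y ∈ Z) → Disjoint ({x, y} : Set V) Z := by
    intro x y hxy
    rw [not_or] at hxy
    rw [Set.disjoint_insert_left, Set.disjoint_singleton_left]
    exact hxy
  have hval : ∀ {p : Word Λ} {α : Valuation V p} {x y i j}, α x = some i → α y = some j →
      ({x, y} : Set V) ⊆ α.dom := by
    rintro p α x y i j hi hj z (rfl | rfl)
    · exact Option.ne_none_iff_exists'.2 ⟨i, hi⟩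
    · exact Option.ne_none_iff_exists'.2 ⟨j, hj⟩
  cases a with
  | top => trivial
  | bot => exact hs.elim
  | empty => exact (hav trivial).elim
  | suc x y => exact (hav trivial).elim
  | min x => exact (hav trivial).elim
  | max x => exact (hav trivial).elim
  | label x c =>
    obtain ⟨i, hi, rfl⟩ := hs
    by_cases hx : x ∈ Z
    · obtain ⟨c, h1, h2⟩ := h.outer x hx
      obtain rfl := Option.some.inj (hi.symm.trans h1)
      exact ⟨_, h2, label_outerPos c⟩
    · obtain ⟨a, b, h1, h2, -, -, -, h3⟩ := h.inner x (hD rfl) hx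
      obtain rfl := Option.some.inj (hi.symm.trans h1)
      exact ⟨_, h2, h3.symm⟩
  | eq x y =>
    obtain ⟨i, i', hi, hi', rfl⟩ := hs
    by_cases hxy : x ∈ Z ∨ y ∈ Z
    · obtain ⟨k, k', j, j', h1, h1', h2, h2', h3, h4⟩ :=
        h.lt_iff_of_outer (hD (.inl rfl)) (hD (.inr rfl)) hxy
      obtain rfl := Option.some.inj (hi.symm.trans h1)
      obtain rfl := Option.some.inj (hi'.symm.trans h1')
      exact ⟨_, _, h2, h2', le_antisymm (not_lt.1 fun hlt => lt_irrefl _ (h4.2 hlt))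
        (not_lt.1 fun hlt => lt_irrefl _ (h3.2 hlt))⟩
    · obtain ⟨a, b, h1, h2, h3, h4, h5, -⟩ := h.inner x (hD (.inl rfl)) fun hx => hxy (.inl hx)
      obtain ⟨a', b', h1', h2', h3', h4', h5', -⟩ :=
        h.inner y (hD (.inr rfl)) fun hx => hxy (.inr hx)
      obtain rfl := Option.some.inj (hi.symm.trans h1)
      have haa : a = a' := Sum.inl_injective (toLex.injective (Sum.inr_injective
        (toLex.injective (Option.some.inj (hi'.symm.trans h1')))))
      subst haa
      obtain ⟨k, k', hk, hk', hkk⟩ := hR.atom h.sim _ (h.mem _ ha (hbin hxy)) (hval h3 h3')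
        (hval h4 h4') ⟨_, _, h3, h3', rfl⟩
      obtain rfl := Option.some.inj (hk.symm.trans h4)
      obtain rfl := Option.some.inj (hk'.symm.trans h4')
      exact ⟨_, _, h2, h2', congrArg _ (g.eq_of hkk (h5.symm.trans h5'))⟩
  | lt x y =>
    obtain ⟨i, i', hi, hi', hlt⟩ := hs
    by_cases hxy : x ∈ Z ∨ y ∈ Z
    · obtain ⟨k, k', j, j', h1, h1', h2, h2', h3, h4⟩ :=
        h.lt_iff_of_outer (hD (.inl rfl)) (hD (.inr rfl)) hxy
      obtain rfl := Option.some.inj (hi.symm.trans h1)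
      obtain rfl := Option.some.inj (hi'.symm.trans h1')
      exact ⟨_, _, h2, h2', h3.1 hlt⟩
    · obtain ⟨a, b, h1, h2, h3, h4, h5, -⟩ := h.inner x (hD (.inl rfl)) fun hx => hxy (.inl hx)
      obtain ⟨a', b', h1', h2', h3', h4', h5', -⟩ :=
        h.inner y (hD (.inr rfl)) fun hx => hxy (.inr hx)
      obtain rfl := Option.some.inj (hi.symm.trans h1)
      obtain rfl := Option.some.inj (hi'.symm.trans h1')
      refine ⟨_, _, h2, h2', innerPos_lt_innerPos.2 ((g.lt_iff _ _).2 ?_)⟩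
      rcases (f.lt_iff _ _).1 (innerPos_lt_innerPos.1 hlt) with hlt | ⟨heq, hlt⟩
      · obtain ⟨k, k', hk, hk', hkk⟩ := hR.atom h.sim _ (h.mem _ ha (hbin hxy)) (hval h3 h3')
          (hval h4 h4') ⟨_, _, h3, h3', hlt⟩
        obtain rfl := Option.some.inj (hk.symm.trans h4)
        obtain rfl := Option.some.inj (hk'.symm.trans h4')
        exact .inl hkk
      -- Strict preservation says nothing about equal addresses. Order-stability supplies `≤` for
      -- the addresses, and the equal offsets on both sides settle a tie.
      · obtain ⟨k, k', hk, hk', hkk⟩ := hR.atom h.sim (.le x y)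
          (h.mem _ ((h.admissible.lt_iff_le .hole x y).1 ha) (hbin hxy)) (hval h3 h3')
          (hval h4 h4') ⟨_, _, h3, h3', heq.le⟩
        obtain rfl := Option.some.inj (hk.symm.trans h4)
        obtain rfl := Option.some.inj (hk'.symm.trans h4')
        rw [h5, h5'] at hlt
        exact hkk.lt_or_eq.imp id fun heq => ⟨heq, hlt⟩
  | le x y =>
    obtain ⟨i, i', hi, hi', hle⟩ := hs
    by_cases hxy : x ∈ Z ∨ y ∈ Z
    · obtain ⟨k, k', j, j', h1, h1', h2, h2', h3, h4⟩ :=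
        h.lt_iff_of_outer (hD (.inl rfl)) (hD (.inr rfl)) hxy
      obtain rfl := Option.some.inj (hi.symm.trans h1)
      obtain rfl := Option.some.inj (hi'.symm.trans h1')
      exact ⟨_, _, h2, h2', not_lt.1 fun hlt => hle.not_gt (h4.2 hlt)⟩
    · obtain ⟨a, b, h1, h2, h3, h4, h5, -⟩ := h.inner x (hD (.inl rfl)) fun hx => hxy (.inl hx)
      obtain ⟨a', b', h1', h2', h3', h4', h5', -⟩ :=
        h.inner y (hD (.inr rfl)) fun hx => hxy (.inr hx)
      obtain rfl := Option.some.inj (hi.symm.trans h1)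
      obtain rfl := Option.some.inj (hi'.symm.trans h1')
      refine ⟨_, _, h2, h2', ?_⟩
      rw [← not_lt, innerPos_lt_innerPos, g.lt_iff]
      rw [← not_lt, innerPos_lt_innerPos, f.lt_iff, not_or, not_lt] at hle
      have hle' : g.addr b ≤ g.addr b' := by
        obtain ⟨k, k', hk, hk', hkk⟩ := hR.atom h.sim _ (h.mem _ ha (hbin hxy)) (hval h3 h3')
          (hval h4 h4') ⟨_, _, h3, h3', hle.1⟩
        obtain rfl := Option.some.inj (hk.symm.trans h4)
        obtain rfl := Option.some.inj (hk'.symm.trans h4')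
        exact hkk
      rintro (hlt | ⟨heq, hlt⟩)
      · exact hle'.not_gt hlt
      · rcases hle.1.lt_or_eq with hlt' | heq'
        -- Conversely, `<` is needed to exclude that distinct addresses on the left become equal on
        -- the right, where the offsets could be in the wrong order.
        · obtain ⟨k, k', hk, hk', hkk⟩ := hR.atom h.sim (.lt x y)
            (h.mem _ ((h.admissible.lt_iff_le .hole x y).2 ha) (hbin hxy)) (hval h3 h3')
            (hval h4 h4') ⟨_, _, h3, h3', hlt'⟩
          obtain rfl := Option.some.inj (hk.symm.trans h4)
          obtain rfl := Option.some.inj (hk'.symm.trans h4')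
          exact hkk.ne' heq
        · exact hle.2 ⟨heq'.symm, by rwa [h5, h5']⟩

/-- Induction on `φ` with the configuration varying: negation interchanges the words, and a
quantifier passes to the reduct. -/
theorem sat (hR : IsSimulation R) {φ : Formula Λ V} (h : Controlled R f g G G' α β α' β' Z D)
    (hφ : φ ∈ G) (hD : φ.freeVars ⊆ D) (hs : φ.Sat _ α') : φ.Sat _ β' := by
  induction φ generalizing P Q p q G G' Z D with
  | atom a => exact h.sat_atom hR hφ hD hs
  | neg φ ih => exact fun hq => hs (ih (h.neg hR) hφ hD hq)
  | or φ ψ ih1 ih2 =>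
    obtain ⟨h1, h2⟩ := (h.admissible.or .hole φ ψ).1 hφ
    exact hs.imp (ih1 h h1 fun x hx => hD (.inl hx)) (ih2 h h2 fun x hx => hD (.inr hx))
  | and φ ψ ih1 ih2 =>
    obtain ⟨h1, h2⟩ := (h.admissible.and .hole φ ψ).1 hφ
    exact hs.imp (ih1 h h1 fun x hx => hD (.inl hx)) (ih2 h h2 fun x hx => hD (.inr hx))
  | ex x φ ih =>
    obtain ⟨i, hi⟩ := hs
    obtain ⟨j, _, _, _, _, h'⟩ := h.exists_ex hR hφ i
    exact ⟨j, ih h' hφ (by simpa [Formula.freeVars] using hD) hi⟩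
  | all x φ ih =>
    intro j
    obtain ⟨i, _, _, _, _, h'⟩ := h.exists_all hR hφ j
    exact ih h' hφ (by simpa [Formula.freeVars] using hD) (hs i)

end Controlled

theorem DuplicatorWins.models_concat {F : Set (Formula Λ V)} (hF : Admissible F)
    {w : Λ → List Λ} {X Y P Q p q : Word Λ} (f : Fibration w P p) (g : Fibration w Q q)
    (h : DuplicatorWins F p q) {φ : Formula Λ V} (hφ : φ ∈ F) (hs : φ.IsSentence)
    (hP : Models (X.concat (P.concat Y)) φ) : Models (X.concat (Q.concat Y)) φ := by
  obtain ⟨R, hR, h0⟩ := h.exists_simulation hF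
  have hc : Controlled R (X := X) (Y := Y) f g F F (Valuation.none V p) (Valuation.none V q)
      (Valuation.none V _) (Valuation.none V _) ∅ ∅ :=
    ⟨hF, h0, fun φ hφ _ => hφ, fun z hz => hz.elim, fun z hz => hz.elim⟩
  exact hc.sat hR hφ hs.subset hP

/-! ### The two implications between identities and games -/

theorem PiTerm.models_rhoWord_of_holdsIn {F : Set (Formula Λ V)} (hF : Admissible F)
    {s t : PiTerm Λ}
    (h : ∀ (A : Finset Λ) (L : Set (FreeMonoid A)), IsDefinableIn F A L →
      HoldsIn s t (SyntacticMonoid L)) {φ : Formula Λ V} (hφ : φ ∈ F) (hs : φ.IsSentence)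
    (hm : Models s.rhoWord φ) : Models t.rhoWord φ := by
  classical
  let A : Finset Λ := (s.letters ++ t.letters).toFinset
  -- Letters outside of `A` occur in neither term, so their value is irrelevant.
  let w : Λ → FreeMonoid A := fun a => if ha : a ∈ A then FreeMonoid.of ⟨a, ha⟩ else 1
  have hav := hF.avoids φ hφ
  have hw : ∀ a ∈ A, BF (toWord (w a)).label (Word.single a).label φ.depth ∅ := by
    intro a ha
    have hwa : w a = FreeMonoid.of ⟨a, ha⟩ := dif_pos ha
    rw [hwa]
    let e : (toWord (FreeMonoid.of (⟨a, ha⟩ : A))).Pos → (Word.single a).Pos := fun _ => ()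
    have hsub : Subsingleton (toWord (FreeMonoid.of (⟨a, ha⟩ : A))).Pos :=
      inferInstanceAs (Subsingleton (Fin 1))
    refine BF.of_graph (e := e) (fun i j hij => (hij.ne (Subsingleton.elim _ _)).elim)
      (fun _ => ⟨(0 : Fin 1), rfl⟩) (fun i => ?_) (fun x hx => hx.elim)
    rw [Subsingleton.elim i (0 : Fin 1)]
    rfl
  have hbs : BF (toWord (s.finWord (2 ^ φ.depth + 1) w)).label s.rhoWord.label φ.depth ∅ :=
    s.bf_finWord le_rfl w Word.single fun a ha => hw a (by simp [A, ha])
  have hbt : BF (toWord (t.finWord (2 ^ φ.depth + 1) w)).label t.rhoWord.label φ.depth ∅ :=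
    t.bf_finWord le_rfl w Word.single fun a ha => hw a (by simp [A, ha])
  have heq := h A (langOf A φ) ⟨φ, hφ, hs, rfl⟩
    fun a => ((w a : FreeMonoid A) : SyntacticMonoid (langOf A φ))
  rw [eval_syntacticMonoid hav hs le_rfl, eval_syntacticMonoid hav hs le_rfl, Con.eq] at heq
  -- The empty context suffices here.
  have h1 := heq 1 1
  rw [one_mul, one_mul, mul_one, mul_one] at h1
  exact (hbt.models_iff hav hs le_rfl).1 (h1.1 ((hbs.models_iff hav hs le_rfl).2 hm))

theorem PiTerm.duplicatorWins_of_holdsIn {F : Set (Formula Λ V)} (hF : Admissible F)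
    {s t : PiTerm Λ}
    (h : ∀ (A : Finset Λ) (L : Set (FreeMonoid A)), IsDefinableIn F A L →
      HoldsIn s t (SyntacticMonoid L)) : DuplicatorWins F s.rhoWord t.rhoWord := by
  have hdom : ∀ p : Word Λ, (Valuation.none V p).dom = ∅ := fun p => by
    simp [Valuation.dom, Valuation.none]
  refine Config.Preserving.duplicatorWins
    ⟨hF, s.saturated_rhoWord, t.saturated_rhoWord, ?_, ?_, fun φ hφ hfree hm => ?_⟩
  · exact (hdom _).trans (hdom _).symm
  · exact (hdom _).symm ▸ Set.finite_empty
  · exact models_rhoWord_of_holdsIn hF h hφ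
      (Set.subset_empty_iff.1 (hfree.trans (hdom _).subset)) hm

/-- Up to the depth of `φ`, the finite words may be replaced by the `ϱ`-words with `w a` substituted
for `a`, placed between `x` and `y`; there `DuplicatorWins.models_concat` applies. -/
theorem PiTerm.mem_langOf_of_duplicatorWins {F : Set (Formula Λ V)} (hF : Admissible F)
    {s t : PiTerm Λ} (h : DuplicatorWins F s.rhoWord t.rhoWord) {A : Finset Λ} {φ : Formula Λ V}
    (hφ : φ ∈ F) (hs : φ.IsSentence) (w : Λ → FreeMonoid A) (x y : FreeMonoid A)
    (hm : x * s.finWord (2 ^ φ.depth + 1) w * y ∈ langOf A φ) :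
    x * t.finWord (2 ^ φ.depth + 1) w * y ∈ langOf A φ := by
  have hav := hF.avoids φ hφ
  have hr : ∀ p : Word Λ, BF p.label p.label φ.depth ∅ := fun p => BF.refl fun x hx => hx.elim
  have key : ∀ r : PiTerm Λ, x * r.finWord (2 ^ φ.depth + 1) w * y ∈ langOf A φ ↔
      Models ((toWord x).concat ((r.substWord fun a => toWord (w a)).concat (toWord y))) φ := by
    intro r
    rw [mul_assoc]
    refine BF.models_iff ((bf_toWord_mul _ _ _).symm_empty.trans_empty ((hr _).concat
      ((bf_toWord_mul _ _ _).symm_empty.trans_empty (BF.concat ?_ (hr _))))) hav hs le_rfl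
    exact r.bf_finWord le_rfl w _ fun a _ => hr _
  obtain ⟨f⟩ := nonempty_fibration (fun a => (w a).toList.map Subtype.val) s
  obtain ⟨g⟩ := nonempty_fibration (fun a => (w a).toList.map Subtype.val) t
  exact (key t).2 (h.models_concat hF f g hφ hs ((key s).1 hm))

end Substitution
end EFTerms

theorem theorem4p1 {Λ : Type*} {V : Type*} [Countable Λ] [Infinite Λ] [Countable V] [Infinite V]
    (F : Set (EFTerms.Formula Λ V)) (hF : EFTerms.IsFragment F) (hord : EFTerms.IsOrderStable F)
    (hpred : ∀ φ ∈ F, φ.AvoidsSucMinMaxEmpty) (s t : EFTerms.PiTerm Λ) :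
    (∀ (A : Finset Λ) (L : Set (FreeMonoid A)), EFTerms.IsDefinableIn F A L →
        Finite (EFTerms.SyntacticMonoid L)) ∧
    ((∀ (A : Finset Λ) (L : Set (FreeMonoid A)), EFTerms.IsDefinableIn F A L →
        EFTerms.HoldsIn s t (EFTerms.SyntacticMonoid L)) ↔
      (EFTerms.DuplicatorWins F s.rhoWord t.rhoWord ∧
        EFTerms.DuplicatorWins F t.rhoWord s.rhoWord)) := by
  have hadm := hF.admissible hord hpred
  refine ⟨?_, fun h => ⟨?_, ?_⟩, ?_⟩
  · rintro A _ ⟨φ, hφ, hs, rfl⟩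
    exact EFTerms.finite_syntacticMonoid (hpred φ hφ) hs
  · exact EFTerms.PiTerm.duplicatorWins_of_holdsIn hadm h
  · exact EFTerms.PiTerm.duplicatorWins_of_holdsIn hadm fun A L hL k => (h A L hL k).symm
  · rintro ⟨h1, h2⟩ A _ ⟨φ, hφ, hs, rfl⟩ k
    -- Every assignment of monoid elements to letters lifts to words by choosing representatives.
    obtain ⟨w, rfl⟩ : ∃ w : Λ → FreeMonoid A,
        k = fun a => ((w a : FreeMonoid A) : EFTerms.SyntacticMonoid (EFTerms.langOf A φ)) :=
      ⟨fun a => Quotient.out (k a), funext fun a => (Quotient.out_eq (k a)).symm⟩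
    rw [EFTerms.eval_syntacticMonoid (hpred φ hφ) hs le_rfl,
      EFTerms.eval_syntacticMonoid (hpred φ hφ) hs le_rfl, Con.eq]
    exact fun x y => ⟨EFTerms.PiTerm.mem_langOf_of_duplicatorWins hadm h1 hφ hs w x y,
      EFTerms.PiTerm.mem_langOf_of_duplicatorWins hadm h2 hφ hs w x y⟩
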